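/- Let $E$ be an infinite-dimensional separable real Hilbert space with an orthonormal basis $\mathcal E=\{e_k\}_{k\ge 1}$, and write $x_k=(x,e_k)$. A block $\Pi_{a,b}=\{x\in E: x_k\in[a_k,b_k)\ \forall k\}$ (with $a,b\in\ell_\infty$, $a_k<b_k$) is called absolutely measurable if it is empty or $\sum_k\max\{0,\ln(b_k-a_k)\}<\infty$; put $\lambda(\Pi_{a,b})=\prod_k(b_k-a_k)$ if $\Pi_{a,b}\ne\emptyset$ and $\lambda(\emptyset)=0$. Let $\lambda$ also denote the finitely additive extension to the ring generated by these blocks and to the completion $\mathcal R$ of this ring with respect to $\lambda$ (a set $A$ belongs to $\mathcal R$ iff for every $\varepsilon>0$ there are $L\subseteq A\subseteq U$ in the ring with $\lambda(U\setminus L)<\varepsilon$). Let $\mathcal H_{\mathcal E}$ be the complex Hilbert space of square integrable functions with respect to $\lambda$, i.e. the completion of the space of complex linear combinations of characteristic functions of sets from $\mathcal R$, with the norm $\|\sum_k c_k\chi_{B_k}\|=(\sum_k|c_k|^2\lambda(B_k))^{1/2}$ for disjoint $B_k$. Let $D$ be a nuclear non-negative self-adjoint operator on $E$ with $De_k=d_ke_k$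 for all $k$, and let $P_n$ be the orthogonal projection onto $\mathrm{span}(e_1,\dots,e_n)$ and $D_n=DP_n$. For $t\ge 0$ let $\widehat{\mathcal U}_{tD_n}$ be the momentum averaging operator on $\mathcal H_{\mathcal E}$, i.e. the operator of multiplication by $\exp\bigl(-\tfrac t2\sum_{k\le n}d_kx_k^2\bigr)$. It is the Gaussian average of shifts in the momentum representation: for all $f,g\in\mathcal H_{\mathcal E}$, $(\widehat{\mathcal U}_{tD_n}f,g)=\int(\widehat S_hf,g)\,d\nu_{tD_n}(h)$, where $\widehat S_h$ is the multiplication by $e^{i(h,x)}$ and $\nu_{tD_n}$ is the centered Gaussian measure on $\mathrm{span}(e_1,\dots,e_n)$ with covariance operator $tD_n$. Then there are bounded linear operators $A_{tD}$, $t\ge0$, on $\mathcal H_{\mathcal E}$ such that for all $T>0$ and $f\in\mathcal H_{\mathcal E}$ $$\lim_{n\to\infty}\sup_{t\in[0,T]}\|A_{tD}f-\widehat{\mathcal U}_{tD_n}f\|_{\mathcal H_{\mathcal E}}=0;$$ in particular $\widehat{\mathcal U}_{D_n}\to A_D$ in the strong operator topology. Moreover $A_{tD}$, $t\ge 0$,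 is a strongly continuous one-parameter semigroup: $A_0=I$, $A_{(s+t)D}=A_{sD}A_{tD}$ for $s,t\ge0$, and $t\mapsto A_{tD}f$ is continuous on $[0,\infty)$ for every $f$. (It is not assumed that $D^{1/2}$ is nuclear.) -/

import Mathlib

noncomputable section

open Set Filter Topology MeasureTheory
open scoped ComplexConjugate

namespace MomentumAveraging

/-! ### Set functions and their linear extension to simple functions -/

section LinearExtension

variable {X : Type*}

/-- The characteristic function of a set, with values in `𝕜`. -/
abbrev chi (𝕜 : Type*) [RCLike 𝕜] (A : Set X) : X → 𝕜 := A.indicator 1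

/-- The space of linear combinations of characteristic functions of sets from `S`. -/
def simpleSpan (𝕜 : Type*) [RCLike 𝕜] (S : Set (Set X)) : Submodule 𝕜 (X → 𝕜) :=
  Submodule.span 𝕜 (chi 𝕜 '' S)

/-- The integral `∑ c_A m(A)` of `f = ∑ c_A χ_A`, a finite linear combination of characteristic
functions of sets `A ∈ S`; it does not depend on the representation of `f` as soon as `m` is
positive on `S` in the sense of `IsPositiveOn`, see `simpleIntegral_eq`. -/
def simpleIntegral (𝕜 : Type*) [RCLike 𝕜] (S : Set (Set X)) (m : Set X → ℝ) (f : X → 𝕜) : 𝕜 :=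
  open Classical in
  if h : ∃ l : Set X →₀ 𝕜, l ∈ Finsupp.supported 𝕜 𝕜 S ∧
      Finsupp.linearCombination 𝕜 (chi 𝕜) l = f
  then Finsupp.linearCombination 𝕜 (fun A => (m A : 𝕜)) h.choose
  else 0

/-- `∑ c_A m(A) ≥ 0` whenever `∑ c_A χ_A ≥ 0`, for finite real combinations of sets from `S`. -/
def IsPositiveOn (S : Set (Set X)) (m : Set X → ℝ) : Prop :=
  ∀ l : Set X →₀ ℝ, l ∈ Finsupp.supported ℝ ℝ S →
    (∀ x, 0 ≤ Finsupp.linearCombination ℝ (chi ℝ) l x) →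
    0 ≤ Finsupp.linearCombination ℝ m l

variable {𝕜 : Type*} [RCLike 𝕜] {S : Set (Set X)} {m : Set X → ℝ}

theorem mem_simpleSpan {f : X → 𝕜} : f ∈ simpleSpan 𝕜 S ↔
    ∃ l ∈ Finsupp.supported 𝕜 𝕜 S, Finsupp.linearCombination 𝕜 (chi 𝕜) l = f :=
  Finsupp.mem_span_image_iff_linearCombination 𝕜

theorem chi_mem {A : Set X} (hA : A ∈ S) : chi 𝕜 A ∈ simpleSpan 𝕜 S :=
  Submodule.subset_span ⟨A, hA, rfl⟩

theorem re_linearCombination_chi (l : Set X →₀ 𝕜) (x : X) :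
    RCLike.re (Finsupp.linearCombination 𝕜 (chi 𝕜) l x) =
      Finsupp.linearCombination ℝ (chi ℝ) (l.mapRange RCLike.re (by simp)) x := by
  rw [Finsupp.linearCombination_apply, Finsupp.linearCombination_apply,
    Finsupp.sum_mapRange_index (by simp)]
  simp only [Finsupp.sum, Finset.sum_apply, map_sum]
  refine Finset.sum_congr rfl fun A _ => ?_
  by_cases hx : x ∈ A <;> simp [hx]

theorem re_linearCombination_measure (l : Set X →₀ 𝕜) :
    RCLike.re (Finsupp.linearCombination 𝕜 (fun A => (m A : 𝕜)) l) =
      Finsupp.linearCombination ℝ m (l.mapRange RCLike.re (by simp)) := by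
  rw [Finsupp.linearCombination_apply, Finsupp.linearCombination_apply,
    Finsupp.sum_mapRange_index (by simp)]
  simp only [Finsupp.sum, map_sum]
  refine Finset.sum_congr rfl fun A _ => ?_
  simp

theorem IsPositiveOn.re_nonneg (hm : IsPositiveOn S m) {l : Set X →₀ 𝕜}
    (hl : l ∈ Finsupp.supported 𝕜 𝕜 S)
    (h0 : ∀ x, 0 ≤ RCLike.re (Finsupp.linearCombination 𝕜 (chi 𝕜) l x)) :
    0 ≤ RCLike.re (Finsupp.linearCombination 𝕜 (fun A => (m A : 𝕜)) l) := by
  rw [re_linearCombination_measure]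
  refine hm _ ?_ fun x => ?_
  · rw [Finsupp.mem_supported] at hl ⊢
    exact subset_trans (by exact_mod_cast Finsupp.support_mapRange) hl
  · rw [← re_linearCombination_chi]; exact h0 x

theorem IsPositiveOn.eq_zero (hm : IsPositiveOn S m) {l : Set X →₀ 𝕜}
    (hl : l ∈ Finsupp.supported 𝕜 𝕜 S) (h0 : Finsupp.linearCombination 𝕜 (chi 𝕜) l = 0) :
    Finsupp.linearCombination 𝕜 (fun A => (m A : 𝕜)) l = 0 := by
  have key : ∀ a : 𝕜, 0 ≤ RCLike.re (a * Finsupp.linearCombination 𝕜 (fun A => (m A : 𝕜)) l) := by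
    intro a
    have := hm.re_nonneg (𝕜 := 𝕜) (l := a • l) (Submodule.smul_mem _ _ hl)
      (by intro x; rw [map_smul, h0]; simp)
    simpa using this
  set z := Finsupp.linearCombination 𝕜 (fun A => (m A : 𝕜)) l
  have h := key (-conj z)
  rw [neg_mul, RCLike.conj_mul, map_neg] at h
  norm_cast at h
  have h2 : ‖z‖ ^ 2 ≤ 0 := by simpa using h
  have h3 : ‖z‖ = 0 := by nlinarith [norm_nonneg z]
  exact norm_eq_zero.1 h3

theorem simpleIntegral_eq (hm : IsPositiveOn S m) {l : Set X →₀ 𝕜}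
    (hl : l ∈ Finsupp.supported 𝕜 𝕜 S) :
    simpleIntegral 𝕜 S m (Finsupp.linearCombination 𝕜 (chi 𝕜) l) =
      Finsupp.linearCombination 𝕜 (fun A => (m A : 𝕜)) l := by
  have h : ∃ l' : Set X →₀ 𝕜, l' ∈ Finsupp.supported 𝕜 𝕜 S ∧
      Finsupp.linearCombination 𝕜 (chi 𝕜) l' = Finsupp.linearCombination 𝕜 (chi 𝕜) l :=
    ⟨l, hl, rfl⟩
  rw [simpleIntegral, dif_pos h, ← sub_eq_zero, ← map_sub]
  refine hm.eq_zero (Submodule.sub_mem _ h.choose_spec.1 hl) ?_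
  rw [map_sub, h.choose_spec.2, sub_self]

theorem simpleIntegral_chi (hm : IsPositiveOn S m) {A : Set X} (hA : A ∈ S) :
    simpleIntegral 𝕜 S m (chi 𝕜 A) = m A := by
  have := simpleIntegral_eq (𝕜 := 𝕜) hm (l := Finsupp.single A 1)
    (Finsupp.single_mem_supported 𝕜 1 hA)
  simpa using this

theorem simpleIntegral_add (hm : IsPositiveOn S m) {f g : X → 𝕜} (hf : f ∈ simpleSpan 𝕜 S)
    (hg : g ∈ simpleSpan 𝕜 S) :
    simpleIntegral 𝕜 S m (f + g) = simpleIntegral 𝕜 S m f + simpleIntegral 𝕜 S m g := by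
  obtain ⟨l, hl, rfl⟩ := mem_simpleSpan.1 hf
  obtain ⟨k, hk, rfl⟩ := mem_simpleSpan.1 hg
  rw [← map_add, simpleIntegral_eq hm (Submodule.add_mem _ hl hk), simpleIntegral_eq hm hl,
    simpleIntegral_eq hm hk, map_add]

theorem simpleIntegral_smul (hm : IsPositiveOn S m) (c : 𝕜) {f : X → 𝕜}
    (hf : f ∈ simpleSpan 𝕜 S) :
    simpleIntegral 𝕜 S m (c • f) = c * simpleIntegral 𝕜 S m f := by
  obtain ⟨l, hl, rfl⟩ := mem_simpleSpan.1 hf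
  rw [← map_smul, simpleIntegral_eq hm (Submodule.smul_mem _ _ hl), simpleIntegral_eq hm hl,
    map_smul, smul_eq_mul]

theorem simpleIntegral_sum (hm : IsPositiveOn S m) {ι : Type*} (s : Finset ι) (c : ι → 𝕜)
    (A : ι → Set X) (hA : ∀ i ∈ s, A i ∈ S) :
    ∑ i ∈ s, c i • chi 𝕜 (A i) ∈ simpleSpan 𝕜 S ∧
      simpleIntegral 𝕜 S m (∑ i ∈ s, c i • chi 𝕜 (A i)) = ∑ i ∈ s, c i * m (A i) := by
  classical
  have hmem : ∀ i ∈ s, c i • chi 𝕜 (A i) ∈ simpleSpan 𝕜 S := fun i hi =>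
    Submodule.smul_mem _ _ (chi_mem (hA i hi))
  refine ⟨Submodule.sum_mem _ hmem, ?_⟩
  induction s using Finset.induction_on with
  | empty => simpa using simpleIntegral_smul hm 0 (simpleSpan 𝕜 S).zero_mem
  | insert i s hi ih =>
    have h1 := hmem i (Finset.mem_insert_self i s)
    have h2 := fun j hj => hmem j (Finset.mem_insert_of_mem (a := j) (b := i) (s := s) hj)
    rw [Finset.sum_insert hi, Finset.sum_insert hi,
      simpleIntegral_add hm h1 (Submodule.sum_mem _ h2),
      ih (fun j hj => hA j (Finset.mem_insert_of_mem hj)) h2,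
      simpleIntegral_smul hm _ (chi_mem (hA i (Finset.mem_insert_self i s))),
      simpleIntegral_chi hm (hA i (Finset.mem_insert_self i s))]

theorem simpleIntegral_re_nonneg (hm : IsPositiveOn S m) {f : X → 𝕜} (hf : f ∈ simpleSpan 𝕜 S)
    (h0 : ∀ x, 0 ≤ RCLike.re (f x)) : 0 ≤ RCLike.re (simpleIntegral 𝕜 S m f) := by
  obtain ⟨l, hl, rfl⟩ := mem_simpleSpan.1 hf
  rw [simpleIntegral_eq hm hl]
  exact hm.re_nonneg hl h0

theorem conj_mem_simpleSpan {f : X → 𝕜} (hf : f ∈ simpleSpan 𝕜 S) :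
    (fun x => conj (f x)) ∈ simpleSpan 𝕜 S := by
  induction hf using Submodule.span_induction with
  | mem f h =>
    obtain ⟨A, hA, rfl⟩ := h
    convert chi_mem (𝕜 := 𝕜) hA using 2 with x
    by_cases hx : x ∈ A <;> simp [hx]
  | zero => convert (simpleSpan 𝕜 S).zero_mem using 2 with x; simp
  | add f g _ _ hf hg => convert (simpleSpan 𝕜 S).add_mem hf hg using 2 with x; simp
  | smul c f _ hf => convert (simpleSpan 𝕜 S).smul_mem (conj c) hf using 2 with x; simp

theorem simpleIntegral_conj (hm : IsPositiveOn S m) {f : X → 𝕜} (hf : f ∈ simpleSpan 𝕜 S) :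
    simpleIntegral 𝕜 S m (fun x => conj (f x)) = conj (simpleIntegral 𝕜 S m f) := by
  induction hf using Submodule.span_induction with
  | mem f h =>
    obtain ⟨A, hA, rfl⟩ := h
    have : (fun x => conj (chi 𝕜 A x)) = chi 𝕜 A := by
      funext x
      by_cases hx : x ∈ A <;> simp [hx]
    rw [this, simpleIntegral_chi hm hA, RCLike.conj_ofReal]
  | zero =>
    have h0 := simpleIntegral_smul hm 0 (simpleSpan 𝕜 S).zero_mem
    rw [zero_smul, zero_mul] at h0
    have : (fun x => conj ((0 : X → 𝕜) x)) = 0 := by funext x; simp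
    rw [this, h0, map_zero]
  | add f g hf' hg' hf hg =>
    have : (fun x => conj ((f + g) x)) = (fun x => conj (f x)) + fun x => conj (g x) := by
      funext x; simp
    rw [this, simpleIntegral_add hm (conj_mem_simpleSpan hf') (conj_mem_simpleSpan hg'), hf, hg,
      simpleIntegral_add hm hf' hg', map_add]
  | smul c f hf' hf =>
    have : (fun x => conj ((c • f) x)) = conj c • fun x => conj (f x) := by
      funext x; simp
    rw [this, simpleIntegral_smul hm _ (conj_mem_simpleSpan hf'), hf,
      simpleIntegral_smul hm _ hf', map_mul]

theorem mul_mem_simpleSpan (hS : ∀ A ∈ S, ∀ B ∈ S, chi 𝕜 (A ∩ B) ∈ simpleSpan 𝕜 S) {f g : X → 𝕜}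
    (hf : f ∈ simpleSpan 𝕜 S) (hg : g ∈ simpleSpan 𝕜 S) : f * g ∈ simpleSpan 𝕜 S := by
  induction hf using Submodule.span_induction with
  | mem f h =>
    obtain ⟨A, hA, rfl⟩ := h
    induction hg using Submodule.span_induction with
    | mem g h =>
      obtain ⟨B, hB, rfl⟩ := h
      convert hS A hA B hB using 1
      funext x
      by_cases hx : x ∈ A <;> by_cases hy : x ∈ B <;> simp [hx, hy]
    | zero => simp
    | add f g _ _ hf hg => rw [mul_add]; exact Submodule.add_mem _ hf hg
    | smul c f _ hf => rw [mul_smul_comm]; exact Submodule.smul_mem _ _ hf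
  | zero => simp
  | add f g _ _ hf hg => rw [add_mul]; exact Submodule.add_mem _ hf hg
  | smul c f _ hf => rw [smul_mul_assoc]; exact Submodule.smul_mem _ _ hf

end LinearExtension

/-! ### Blocks and the shift-invariant measure -/

section Blocks

variable {E : Type*} [NormedAddCommGroup E] [InnerProductSpace ℝ E] (e : HilbertBasis ℕ ℝ E)

/-- The `k`-th coordinate of `x` in the orthonormal basis `e`. -/
abbrev coord (k : ℕ) (x : E) : ℝ := inner ℝ (e k) x

/-- The block `Π_{a,b} = {x : x_j ∈ [a_j, b_j) for all j}`. -/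
def block (a b : ℕ → ℝ) : Set E := {x | ∀ j, coord e j x ∈ Ico (a j) (b j)}

/-- `Q` is an absolutely measurable block with edges collinear to the basis vectors. -/
def IsMeasurableBlock (Q : Set E) : Prop :=
  ∃ a b : ℕ → ℝ, (∃ M, ∀ j, |a j| ≤ M ∧ |b j| ≤ M) ∧ (∀ j, a j < b j) ∧ Q = block e a b ∧
    (Q = ∅ ∨ Summable fun j => max 0 (Real.log (b j - a j)))

/-- The volume of a block: `∏ (b_j - a_j)` for a nonempty block `Π_{a,b}` (which determines its
edges `[a_j, b_j)`, see `blockVolume_eq`), and `0` for the empty one. -/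
def blockVolume (Q : Set E) : ℝ :=
  open Classical in
  if h : Q.Nonempty ∧ ∃ p : (ℕ → ℝ) × (ℕ → ℝ), (∀ j, p.1 j < p.2 j) ∧ Q = block e p.1 p.2
  then ∏' j, (h.2.choose.2 j - h.2.choose.1 j)
  else 0

variable {e}

theorem exists_coord {y : ℕ → ℝ} (hy : Summable fun j => y j ^ 2) :
    ∃ x : E, ∀ j, coord e j x = y j := by
  have h : Memℓp y 2 := by
    rw [memℓp_gen_iff (by simp)]
    simpa using hy
  refine ⟨e.repr.symm ⟨y, h⟩, fun j => ?_⟩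
  rw [coord, ← e.repr_apply_apply]
  simp

theorem summable_coord_sq (x : E) : Summable fun j => coord e j x ^ 2 := by
  have h := lp.memℓp (e.repr x)
  rw [memℓp_gen_iff (by simp)] at h
  simpa [e.repr_apply_apply] using h

/-- A single coordinate of a point can be changed at will. -/
theorem exists_update (x : E) (k : ℕ) (s : ℝ) :
    ∃ y : E, coord e k y = s ∧ ∀ j, j ≠ k → coord e j y = coord e j x := by
  refine ⟨x + (s - coord e k x) • e k, ?_, fun j hj => ?_⟩
  · have : inner ℝ (e k) (e k) = (1 : ℝ) := by
      simp [e.orthonormal.1 k]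
    rw [coord, inner_add_right, inner_smul_right, this]
    ring
  · have : inner ℝ (e j) (e k) = (0 : ℝ) := e.orthonormal.2 hj
    rw [coord, inner_add_right, inner_smul_right, this]
    ring

theorem block_le {a b c d : ℕ → ℝ} (h : block e a b ⊆ block e c d) (hne : (block e a b).Nonempty)
    (j : ℕ) {s : ℝ} (hs : s ∈ Ico (a j) (b j)) : s ∈ Ico (c j) (d j) := by
  obtain ⟨x, hx⟩ := hne
  obtain ⟨y, hy, hy'⟩ := exists_update (e := e) x j s
  have hy2 : y ∈ block e a b := fun i => by
    by_cases hi : i = j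
    · subst hi; rwa [hy]
    · rw [hy' i hi]; exact hx i
  simpa [hy] using h hy2 j

theorem block_inj {a b c d : ℕ → ℝ} (hab : ∀ j, a j < b j)
    (h : block e a b = block e c d) (hne : (block e a b).Nonempty) : a = c ∧ b = d := by
  have key : ∀ j, Ico (a j) (b j) = Ico (c j) (d j) := fun j =>
    Subset.antisymm (fun s hs => block_le h.subset hne j hs)
      (fun s hs => block_le h.symm.subset (h ▸ hne) j hs)
  have := fun j => (Ico_eq_Ico_iff (Or.inl (hab j))).1 (key j)
  exact ⟨funext fun j => (this j).1, funext fun j => (this j).2⟩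

theorem blockVolume_empty : blockVolume e (∅ : Set E) = 0 := by
  rw [blockVolume, dif_neg]
  rintro ⟨h, -⟩
  exact not_nonempty_empty h

theorem blockVolume_eq {a b : ℕ → ℝ} (hab : ∀ j, a j < b j) (hne : (block e a b).Nonempty) :
    blockVolume e (block e a b) = ∏' j, (b j - a j) := by
  have h : (block e a b).Nonempty ∧ ∃ p : (ℕ → ℝ) × (ℕ → ℝ), (∀ j, p.1 j < p.2 j) ∧
      block e a b = block e p.1 p.2 := ⟨hne, (a, b), hab, rfl⟩
  rw [blockVolume, dif_pos h]
  obtain ⟨h1, h2⟩ := block_inj hab h.2.choose_spec.2 hne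
  rw [← h1, ← h2]

theorem multipliable_of_summable {x : ℕ → ℝ} (hx : ∀ j, 0 < x j)
    (h : Summable fun j => max 0 (Real.log (x j))) : Multipliable x := by
  have h1 : Multipliable fun j => max 1 (x j) := by
    refine Real.multipliable_of_summable_log (fun j => lt_max_of_lt_left one_pos) ?_
    refine h.congr fun j => ?_
    rcases le_total 1 (x j) with h1 | h1
    · rw [max_eq_right h1, max_eq_right (Real.log_nonneg h1)]
    · rw [max_eq_left h1, Real.log_one, max_eq_left (Real.log_nonpos (hx j).le h1)]
  have h2 : Multipliable fun j => min 1 (x j) := by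
    have hp : ∀ j, 0 < min 1 (x j) := fun j => lt_min one_pos (hx j)
    refine ⟨⨅ s : Finset ℕ, ∏ j ∈ s, min 1 (x j), ?_⟩
    refine tendsto_atTop_ciInf (fun s t hst => ?_) ⟨0, ?_⟩
    · exact Finset.prod_le_prod_of_subset_of_le_one hst (fun j _ => (hp j).le)
        (fun j _ _ => min_le_left _ _)
    · rintro _ ⟨s, rfl⟩
      exact Finset.prod_nonneg fun j _ => (hp j).le
  refine (h1.mul h2).congr fun j => ?_
  rw [max_mul_min, one_mul]

theorem block_inter (a b c d : ℕ → ℝ) :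
    block e a b ∩ block e c d = block e (fun j => max (a j) (c j)) fun j => min (b j) (d j) := by
  ext x
  simp only [block, mem_inter_iff, mem_ofPred_eq, mem_Ico, max_le_iff, lt_min_iff]
  grind

/-- The intersection of an absolutely measurable block with a bounded one. -/
theorem IsMeasurableBlock.inter_block {Q : Set E} (hQ : IsMeasurableBlock e Q) {c d : ℕ → ℝ}
    (hcd : ∃ M, ∀ j, |c j| ≤ M ∧ |d j| ≤ M) :
    Q ∩ block e c d = ∅ ∨ IsMeasurableBlock e (Q ∩ block e c d) := by
  rcases (Q ∩ block e c d).eq_empty_or_nonempty with h0 | h0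
  · exact Or.inl h0
  right
  obtain ⟨a, b, ⟨M, hM⟩, hab, rfl, hs⟩ := hQ
  obtain ⟨N, hN⟩ := hcd
  have hs' := hs.resolve_left (h0.mono inter_subset_left).ne_empty
  rw [block_inter] at h0 ⊢
  obtain ⟨x, hx⟩ := h0
  have hlt : ∀ j, max (a j) (c j) < min (b j) (d j) := fun j => (hx j).1.trans_lt (hx j).2
  refine ⟨_, _, ⟨max M N, fun j => ⟨?_, ?_⟩⟩, hlt, rfl, Or.inr ?_⟩
  · exact abs_max_le_max_abs_abs.trans (max_le_max (hM j).1 (hN j).1)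
  · exact abs_min_le_max_abs_abs.trans (max_le_max (hM j).2 (hN j).2)
  · refine Summable.of_nonneg_of_le (fun j => le_max_left _ _) (fun j => ?_) hs'
    refine max_le_max le_rfl (Real.log_le_log (sub_pos.2 (hlt j)) ?_)
    linarith [min_le_left (b j) (d j), le_max_left (a j) (c j)]

theorem chi_inter_mem (𝕜 : Type*) [RCLike 𝕜] {Q W : Set E} (hQ : IsMeasurableBlock e Q)
    (hW : IsMeasurableBlock e W) :
    chi 𝕜 (Q ∩ W) ∈ simpleSpan 𝕜 {Q | IsMeasurableBlock e Q} := by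
  obtain ⟨c, d, hM, -, rfl, -⟩ := hW
  rcases hQ.inter_block hM with h | h
  · rw [h]
    rw [chi, indicator_empty]
    exact Submodule.zero_mem _
  · exact chi_mem h

/-- Intervals which meet pairwise have a common point, which is no larger in absolute value than
prescribed points of the intervals. -/
theorem exists_common_point {ι : Type*} {s : Finset ι} (hs : s.Nonempty) {a b x : ι → ℝ}
    (hx : ∀ i ∈ s, x i ∈ Ico (a i) (b i)) (h : ∀ i ∈ s, ∀ k ∈ s, a i < b k) :
    ∃ z, (∀ i ∈ s, z ∈ Ico (a i) (b i)) ∧ ∃ i ∈ s, |z| ≤ |x i| := by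
  obtain ⟨i, hi, hmax⟩ := s.exists_max_image a hs
  obtain ⟨k, hk, hmin⟩ := s.exists_min_image x hs
  refine ⟨max (a i) (x k), fun l hl => ⟨le_max_of_le_left (hmax l hl), max_lt (h i hi l hl)
    ((hmin l hl).trans_lt (hx l hl).2)⟩, ?_⟩
  rcases le_total (a i) (x k) with h1 | h1
  · exact ⟨k, hk, by rw [max_eq_right h1]⟩
  · rw [max_eq_left h1]
    have h2 := (hx i hi).1
    rcases le_total 0 (a i) with h3 | h3
    · exact ⟨i, hi, by rw [abs_of_nonneg h3, abs_of_nonneg (h3.trans h2)]; exact h2⟩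
    · exact ⟨k, hk, by rw [abs_of_nonpos h3, abs_of_nonpos (h1.trans h3)]; linarith⟩

/-- A finite family of nonempty blocks, projected to the first `n` coordinates for a large `n`:
the blocks whose projections contain a given point have a common point. -/
theorem exists_projection (F : Finset (Set E)) {a b : Set E → ℕ → ℝ}
    (hF : ∀ Q ∈ F, Q = block e (a Q) (b Q) ∧ Q.Nonempty) :
    ∃ N : ℕ, ∀ n ≥ N, ∀ y : Fin n → ℝ,
      (∀ Q ∈ F, ∃ k : Fin n, y k ∉ Ico (a Q k) (b Q k)) ∨
      ∃ x : E, ∀ Q ∈ F, (x ∈ Q ↔ ∀ k : Fin n, y k ∈ Ico (a Q k) (b Q k)) := by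
  classical
  have hsep : ∀ Q W : Set E, ∃ j : ℕ, (∃ j, ¬ a Q j < b W j) → ¬ a Q j < b W j := fun Q W => by
    by_cases h : ∃ j, ¬ a Q j < b W j
    · obtain ⟨j, hj⟩ := h
      exact ⟨j, fun _ => hj⟩
    · exact ⟨0, fun h' => absurd h' h⟩
  choose J hJ using hsep
  choose! p hp using fun Q hQ => (hF Q hQ).2
  refine ⟨(F ×ˢ F).sup (fun r => J r.1 r.2) + 1, fun n hn y => ?_⟩
  set I := F.filter fun Q => ∀ k : Fin n, y k ∈ Ico (a Q k) (b Q k) with hI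
  rcases I.eq_empty_or_nonempty with h0 | h0
  · left
    intro Q hQ
    by_contra! hc
    have : Q ∈ I := by rw [hI, Finset.mem_filter]; exact ⟨hQ, hc⟩
    simp [h0] at this
  right
  have hIF : ∀ Q ∈ I, Q ∈ F := fun Q hQ => (Finset.mem_filter.1 hQ).1
  have hlt : ∀ j, ∀ Q ∈ I, ∀ W ∈ I, a Q j < b W j := by
    intro j Q hQ W hW
    by_contra hc
    have h1 := hJ Q W ⟨j, hc⟩
    have h2 : J Q W < n := by
      have : J Q W ≤ (F ×ˢ F).sup (fun r => J r.1 r.2) :=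
        Finset.le_sup (f := fun r : Set E × Set E => J r.1 r.2)
          (Finset.mem_product.2 ⟨hIF Q hQ, hIF W hW⟩ : (Q, W) ∈ F ×ˢ F)
      omega
    have h3 := (Finset.mem_filter.1 hQ).2 ⟨_, h2⟩
    have h4 := (Finset.mem_filter.1 hW).2 ⟨_, h2⟩
    exact h1 (h3.1.trans_lt h4.2)
  have hpm : ∀ Q ∈ I, ∀ j, coord e j (p Q) ∈ Ico (a Q j) (b Q j) := fun Q hQ j => by
    have h1 := hp Q (hIF Q hQ)
    rw [(hF Q (hIF Q hQ)).1] at h1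
    have h2 := h1 j
    rwa [← (hF Q (hIF Q hQ)).1] at h2
  choose z hz hz' using fun j => exists_common_point h0 (fun Q hQ => hpm Q hQ j) (hlt j)
  have hsum : Summable fun j => (if h : j < n then y ⟨j, h⟩ else z j) ^ 2 := by
    rw [← summable_nat_add_iff n]
    refine Summable.of_nonneg_of_le (fun j => sq_nonneg _) (fun j => ?_)
      (summable_nat_add_iff n |>.2
        (summable_sum fun Q (_ : Q ∈ I) => summable_coord_sq (e := e) (p Q)))
    rw [dif_neg (by omega)]
    obtain ⟨Q, hQ, hle⟩ := hz' (j + n)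
    exact (sq_le_sq.2 hle).trans
      (Finset.single_le_sum (f := fun Q => coord e (j + n) (p Q) ^ 2)
        (fun _ _ => sq_nonneg _) hQ)
  obtain ⟨x, hx⟩ := exists_coord (e := e) hsum
  refine ⟨x, fun Q hQ => ⟨fun hxQ k => ?_, fun hk => ?_⟩⟩
  · rw [(hF Q hQ).1] at hxQ
    have := hxQ k
    rw [hx, dif_pos k.2] at this
    exact this
  · have hQI : Q ∈ I := Finset.mem_filter.2 ⟨hQ, hk⟩
    have hmem : x ∈ block e (a Q) (b Q) := by
      intro j
      rw [hx]
      by_cases hj : j < n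
      · rw [dif_pos hj]; exact hk ⟨j, hj⟩
      · rw [dif_neg hj]; exact hz j Q hQI
    rwa [← (hF Q hQ).1] at hmem

/-- The volume of blocks is a positive set function. -/
theorem isPositiveOn_blockVolume :
    IsPositiveOn {Q : Set E | IsMeasurableBlock e Q} (blockVolume e) := by
  classical
  intro l hl h0
  rw [Finsupp.mem_supported] at hl
  choose! a b hM hab heq hs using fun Q (hQ : IsMeasurableBlock e Q) => hQ
  set F := l.support.filter Set.Nonempty with hF
  have hFm : ∀ Q ∈ F, IsMeasurableBlock e Q := fun Q hQ => hl (Finset.mem_filter.1 hQ).1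
  have hFn : ∀ Q ∈ F, Q.Nonempty := fun Q hQ => (Finset.mem_filter.1 hQ).2
  obtain ⟨N, hN⟩ := exists_projection F (a := a) (b := b)
    fun Q hQ => ⟨heq Q (hFm Q hQ), hFn Q hQ⟩
  have hfx : ∀ x : E, 0 ≤ ∑ Q ∈ F, l Q * chi ℝ Q x := fun x => by
    have h1 := h0 x
    rw [Finsupp.linearCombination_apply, Finsupp.sum, Finset.sum_apply] at h1
    rw [hF, Finset.sum_filter_of_ne]
    · simpa using h1
    · intro Q _ hne
      by_contra hc
      rw [not_nonempty_iff_eq_empty.1 hc] at hne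
      simp at hne
  have hpos : ∀ n ≥ N, 0 ≤ ∑ Q ∈ F, l Q * ∏ k : Fin n, (b Q k - a Q k) := by
    intro n hn
    set B : Set E → Set (Fin n → ℝ) := fun Q => univ.pi fun k => Ico (a Q k) (b Q k) with hB
    have hBm : ∀ Q, MeasurableSet (B Q) := fun Q => MeasurableSet.univ_pi fun _ => measurableSet_Ico
    have hBf : ∀ Q, volume (B Q) ≠ ⊤ := fun Q => by
      rw [hB, Real.volume_pi_Ico]
      exact ENNReal.prod_ne_top fun _ _ => ENNReal.ofReal_ne_top
    have hint : ∫ y, ∑ Q ∈ F, l Q * (B Q).indicator (fun _ => (1 : ℝ)) y =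
        ∑ Q ∈ F, l Q * ∏ k : Fin n, (b Q k - a Q k) := by
      rw [integral_finsetSum]
      · refine Finset.sum_congr rfl fun Q hQ => ?_
        rw [integral_const_mul, integral_indicator (hBm Q), setIntegral_const, smul_eq_mul, mul_one,
          Measure.real, hB, Real.volume_pi_Ico_toReal]
        exact fun k => (hab Q (hFm Q hQ) k).le
      · intro Q _
        exact ((integrable_indicator_iff (hBm Q)).2
          (integrableOn_const (hBf Q))).const_mul _
    rw [← hint]
    refine integral_nonneg fun y => ?_
    rcases hN n hn y with h | ⟨x, hx⟩
    · refine (Finset.sum_eq_zero fun Q hQ => ?_).ge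
      obtain ⟨k, hk⟩ := h Q hQ
      rw [indicator_of_notMem, mul_zero]
      exact fun hy => hk (hy k (mem_univ k))
    · refine (hfx x).trans_eq (Finset.sum_congr rfl fun Q hQ => ?_)
      congr 1
      have : x ∈ Q ↔ y ∈ B Q := by rw [hx Q hQ]; simp [hB]
      by_cases hxQ : x ∈ Q
      · rw [chi, indicator_of_mem hxQ, indicator_of_mem (this.1 hxQ)]; rfl
      · rw [chi, indicator_of_notMem hxQ, indicator_of_notMem (fun h => hxQ (this.2 h))]
  have hlim : Tendsto (fun n : ℕ => ∑ Q ∈ F, l Q * ∏ k : Fin n, (b Q k - a Q k)) atTop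
      (𝓝 (∑ Q ∈ F, l Q * blockVolume e Q)) := by
    refine tendsto_finsetSum _ fun Q hQ => Tendsto.const_mul _ ?_
    have hv : blockVolume e Q = ∏' j, (b Q j - a Q j) := by
      have h1 := blockVolume_eq (e := e) (hab Q (hFm Q hQ))
      rw [← heq Q (hFm Q hQ)] at h1
      exact h1 (hFn Q hQ)
    rw [hv]
    have hmul : Multipliable fun j => b Q j - a Q j :=
      multipliable_of_summable (fun j => sub_pos.2 (hab Q (hFm Q hQ) j))
        ((hs Q (hFm Q hQ)).resolve_left (hFn Q hQ).ne_empty)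
    refine hmul.hasProd.tendsto_prod_nat.congr fun n => ?_
    rw [Finset.prod_range]
  have hfin := ge_of_tendsto' (hlim.comp (tendsto_add_atTop_nat N))
    fun n => hpos (n + N) (Nat.le_add_left _ _)
  rw [Finsupp.linearCombination_apply, Finsupp.sum]
  rw [hF, Finset.sum_filter_of_ne] at hfin
  · simpa using hfin
  · intro Q _ hne
    by_contra hc
    rw [not_nonempty_iff_eq_empty.1 hc, blockVolume_empty] at hne
    simp at hne

variable (e) in
/-- The smallest ring of sets which contains all absolutely measurable blocks. -/
def blockRing : Set (Set E) :=
  {A | ∀ R : Set (Set E), IsSetRing R → (∀ Q, IsMeasurableBlock e Q → Q ∈ R) → A ∈ R}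

variable (e) in
/-- The finitely additive extension of the block volume to `blockRing`: the characteristic function
of a set from the ring is a finite combination `∑ c_Q χ_Q` of characteristic functions of blocks, and
its measure is `∑ c_Q vol(Q)`. -/
def ringMeasure (A : Set E) : ℝ :=
  simpleIntegral ℝ {Q : Set E | IsMeasurableBlock e Q} (blockVolume e) (chi ℝ A)

variable (e) in
/-- The completion of `blockRing` with respect to `ringMeasure`. -/
def completedRing : Set (Set E) :=
  {A | ∀ ε > 0, ∃ L ∈ blockRing e, ∃ U ∈ blockRing e, L ⊆ A ∧ A ⊆ U ∧ ringMeasure e (U \ L) < ε}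

variable (e) in
/-- The shift-invariant finitely additive measure `λ` on `completedRing`. -/
def shiftMeasure (A : Set E) : ℝ :=
  sInf (ringMeasure e '' {U | U ∈ blockRing e ∧ A ⊆ U})

theorem isSetRing_blockRing : IsSetRing (blockRing e) where
  empty_mem := fun _ hR _ => hR.empty_mem
  union_mem := fun _ _ hs ht R hR h => hR.union_mem (hs R hR h) (ht R hR h)
  sdiff_mem := fun _ _ hs ht R hR h => hR.sdiff_mem (hs R hR h) (ht R hR h)

theorem block_mem_blockRing {Q : Set E} (hQ : IsMeasurableBlock e Q) : Q ∈ blockRing e :=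
  fun _ _ h => h Q hQ

theorem chi_mem_of_mem_blockRing (𝕜 : Type*) [RCLike 𝕜] {A : Set E} (hA : A ∈ blockRing e) :
    chi 𝕜 A ∈ simpleSpan 𝕜 {Q | IsMeasurableBlock e Q} := by
  have hmul : ∀ {f g : E → 𝕜}, f ∈ simpleSpan 𝕜 {Q | IsMeasurableBlock e Q} →
      g ∈ simpleSpan 𝕜 {Q | IsMeasurableBlock e Q} →
      f * g ∈ simpleSpan 𝕜 {Q | IsMeasurableBlock e Q} := fun hf hg =>
    mul_mem_simpleSpan (fun _ hQ _ hW => chi_inter_mem 𝕜 hQ hW) hf hg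
  refine hA {A | chi 𝕜 A ∈ simpleSpan 𝕜 {Q | IsMeasurableBlock e Q}} ⟨?_, ?_, ?_⟩
    fun Q hQ => chi_mem (S := {Q | IsMeasurableBlock e Q}) hQ
  · change chi 𝕜 (∅ : Set E) ∈ simpleSpan 𝕜 {Q | IsMeasurableBlock e Q}
    rw [chi, indicator_empty]
    exact Submodule.zero_mem _
  · intro s t hs ht
    change chi 𝕜 (s ∪ t) ∈ simpleSpan 𝕜 {Q | IsMeasurableBlock e Q}
    convert Submodule.sub_mem _ (Submodule.add_mem _ hs ht) (hmul hs ht) using 1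
    funext x
    by_cases hx : x ∈ s <;> by_cases hy : x ∈ t <;> simp [hx, hy]
  · intro s t hs ht
    change chi 𝕜 (s \ t) ∈ simpleSpan 𝕜 {Q | IsMeasurableBlock e Q}
    convert Submodule.sub_mem _ hs (hmul hs ht) using 1
    funext x
    by_cases hx : x ∈ s <;> by_cases hy : x ∈ t <;> simp [hx, hy]

theorem isPositiveOn_ringMeasure : IsPositiveOn (blockRing e) (ringMeasure e) := by
  intro l hl h0
  rw [Finsupp.mem_supported] at hl
  have key : Finsupp.linearCombination ℝ (chi ℝ) l ∈
      simpleSpan ℝ {Q : Set E | IsMeasurableBlock e Q} ∧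
      Finsupp.linearCombination ℝ (ringMeasure e) l =
      simpleIntegral ℝ {Q : Set E | IsMeasurableBlock e Q} (blockVolume e)
        (Finsupp.linearCombination ℝ (chi ℝ) l) := by
    clear h0
    rw [← Finsupp.mem_supported ℝ, Finsupp.supported_eq_span_single] at hl
    induction hl using Submodule.span_induction with
    | mem l h =>
      obtain ⟨A, hA, rfl⟩ := h
      simp only [Finsupp.linearCombination_single, one_smul]
      exact ⟨chi_mem_of_mem_blockRing ℝ hA, rfl⟩
    | zero =>
      refine ⟨by simp, ?_⟩
      have := simpleIntegral_smul (𝕜 := ℝ) (isPositiveOn_blockVolume (e := e)) 0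
        (Submodule.zero_mem _)
      simpa using this.symm
    | add l k _ _ hl hk =>
      rw [map_add, map_add]
      exact ⟨Submodule.add_mem _ hl.1 hk.1,
        by rw [simpleIntegral_add isPositiveOn_blockVolume hl.1 hk.1, hl.2, hk.2]⟩
    | smul c l _ hl =>
      rw [map_smul, map_smul]
      exact ⟨Submodule.smul_mem _ _ hl.1,
        by rw [simpleIntegral_smul isPositiveOn_blockVolume c hl.1, hl.2, smul_eq_mul]⟩
  rw [key.2]
  exact simpleIntegral_re_nonneg isPositiveOn_blockVolume key.1 h0

theorem ringMeasure_eq_blockVolume {Q : Set E} (hQ : IsMeasurableBlock e Q) :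
    ringMeasure e Q = blockVolume e Q :=
  simpleIntegral_chi (𝕜 := ℝ) (isPositiveOn_blockVolume (e := e)) hQ

theorem ringMeasure_union {A B : Set E} (hA : A ∈ blockRing e) (hB : B ∈ blockRing e)
    (h : Disjoint A B) : ringMeasure e (A ∪ B) = ringMeasure e A + ringMeasure e B := by
  rw [ringMeasure, ringMeasure, ringMeasure, ← simpleIntegral_add isPositiveOn_blockVolume
    (chi_mem_of_mem_blockRing ℝ hA) (chi_mem_of_mem_blockRing ℝ hB)]
  congr 1
  exact indicator_union_of_disjoint h _

theorem ringMeasure_nonneg {A : Set E} (hA : A ∈ blockRing e) : 0 ≤ ringMeasure e A :=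
  simpleIntegral_re_nonneg (𝕜 := ℝ) isPositiveOn_blockVolume (chi_mem_of_mem_blockRing ℝ hA)
    fun x => by
      by_cases hx : x ∈ A <;> simp [hx]

theorem ringMeasure_sdiff {A B : Set E} (hA : A ∈ blockRing e) (hB : B ∈ blockRing e)
    (h : A ⊆ B) : ringMeasure e (B \ A) = ringMeasure e B - ringMeasure e A := by
  rw [eq_sub_iff_add_eq, ← ringMeasure_union (isSetRing_blockRing.sdiff_mem hB hA) hA
    disjoint_sdiff_left, sdiff_union_of_subset h]

theorem ringMeasure_mono {A B : Set E} (hA : A ∈ blockRing e) (hB : B ∈ blockRing e)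
    (h : A ⊆ B) : ringMeasure e A ≤ ringMeasure e B := by
  have := ringMeasure_nonneg (isSetRing_blockRing.sdiff_mem hB hA)
  rw [ringMeasure_sdiff hA hB h] at this
  linarith

theorem ringMeasure_union_le {A B : Set E} (hA : A ∈ blockRing e) (hB : B ∈ blockRing e) :
    ringMeasure e (A ∪ B) ≤ ringMeasure e A + ringMeasure e B := by
  rw [← union_sdiff_self, ringMeasure_union hA (isSetRing_blockRing.sdiff_mem hB hA)
    disjoint_sdiff_right]
  exact add_le_add_right (ringMeasure_mono (isSetRing_blockRing.sdiff_mem hB hA) hB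
    sdiff_subset) _

theorem blockRing_subset_completedRing : blockRing e ⊆ completedRing e := fun A hA ε hε =>
  ⟨A, hA, A, hA, subset_rfl, subset_rfl, by
    rw [ringMeasure_sdiff hA hA subset_rfl, sub_self]; exact hε⟩

theorem shiftMeasure_bounds {L A U : Set E} (hL : L ∈ blockRing e) (hU : U ∈ blockRing e)
    (hLA : L ⊆ A) (hAU : A ⊆ U) :
    ringMeasure e L ≤ shiftMeasure e A ∧ shiftMeasure e A ≤ ringMeasure e U := by
  constructor
  · refine le_csInf ⟨_, U, ⟨hU, hAU⟩, rfl⟩ ?_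
    rintro _ ⟨V, ⟨hV, hAV⟩, rfl⟩
    exact ringMeasure_mono hL hV (hLA.trans hAV)
  · refine csInf_le ⟨0, ?_⟩ ⟨U, ⟨hU, hAU⟩, rfl⟩
    rintro _ ⟨V, ⟨hV, hAV⟩, rfl⟩
    exact ringMeasure_nonneg hV

theorem shiftMeasure_eq_ringMeasure {A : Set E} (hA : A ∈ blockRing e) :
    shiftMeasure e A = ringMeasure e A :=
  have h := shiftMeasure_bounds hA hA subset_rfl subset_rfl
  le_antisymm h.2 h.1

theorem isSetRing_completedRing : IsSetRing (completedRing e) where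
  empty_mem := blockRing_subset_completedRing isSetRing_blockRing.empty_mem
  union_mem := by
    intro s t hs ht ε hε
    obtain ⟨L, hL, U, hU, hLs, hsU, h⟩ := hs (ε / 2) (half_pos hε)
    obtain ⟨L', hL', U', hU', hLs', hsU', h'⟩ := ht (ε / 2) (half_pos hε)
    have hR := isSetRing_blockRing (e := e)
    refine ⟨L ∪ L', hR.union_mem hL hL', U ∪ U', hR.union_mem hU hU', union_subset_union hLs hLs',
      union_subset_union hsU hsU', ?_⟩
    have h1 := ringMeasure_mono (hR.sdiff_mem (hR.union_mem hU hU') (hR.union_mem hL hL'))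
      (hR.union_mem (hR.sdiff_mem hU hL) (hR.sdiff_mem hU' hL')) (by
        rintro x ⟨hx | hx, hx'⟩
        · exact Or.inl ⟨hx, fun h => hx' (Or.inl h)⟩
        · exact Or.inr ⟨hx, fun h => hx' (Or.inr h)⟩)
    have h2 := ringMeasure_union_le (hR.sdiff_mem hU hL) (hR.sdiff_mem hU' hL')
    linarith
  sdiff_mem := by
    intro s t hs ht ε hε
    obtain ⟨L, hL, U, hU, hLs, hsU, h⟩ := hs (ε / 2) (half_pos hε)
    obtain ⟨L', hL', U', hU', hLs', hsU', h'⟩ := ht (ε / 2) (half_pos hε)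
    have hR := isSetRing_blockRing (e := e)
    refine ⟨L \ U', hR.sdiff_mem hL hU', U \ L', hR.sdiff_mem hU hL', sdiff_subset_sdiff hLs hsU',
      sdiff_subset_sdiff hsU hLs', ?_⟩
    have h1 := ringMeasure_mono (hR.sdiff_mem (hR.sdiff_mem hU hL') (hR.sdiff_mem hL hU'))
      (hR.union_mem (hR.sdiff_mem hU hL) (hR.sdiff_mem hU' hL')) (by
        rintro x ⟨⟨hx, hx1⟩, hx2⟩
        by_cases h : x ∈ L
        · exact Or.inr ⟨by_contra fun h' => hx2 ⟨h, h'⟩, hx1⟩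
        · exact Or.inl ⟨hx, h⟩)
    have h2 := ringMeasure_union_le (hR.sdiff_mem hU hL) (hR.sdiff_mem hU' hL')
    linarith

theorem isPositiveOn_shiftMeasure : IsPositiveOn (completedRing e) (shiftMeasure e) := by
  intro l hl h0
  rw [Finsupp.mem_supported] at hl
  rw [Finsupp.linearCombination_apply, Finsupp.sum]
  simp only [Finsupp.linearCombination_apply, Finsupp.sum, Finset.sum_apply, Pi.smul_apply] at h0
  set C := ∑ A ∈ l.support, |l A| with hC
  have hC0 : 0 ≤ C := Finset.sum_nonneg fun _ _ => abs_nonneg _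
  have key : ∀ δ > 0, 0 ≤ ∑ A ∈ l.support, l A • shiftMeasure e A + (2 * C) * δ := by
    intro δ hδ
    have hR := isSetRing_blockRing (e := e)
    choose! L hL U hU hLA hAU hlt using fun A (hA : A ∈ l.support) => hl hA δ hδ
    have h1 := simpleIntegral_sum (𝕜 := ℝ) (isPositiveOn_ringMeasure (e := e)) l.support l U hU
    have h2 := simpleIntegral_sum (𝕜 := ℝ) (isPositiveOn_ringMeasure (e := e)) l.support
      (fun A => |l A|) (fun A => U A \ L A) fun A hA => hR.sdiff_mem (hU A hA) (hL A hA)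
    have h3 := simpleIntegral_re_nonneg (𝕜 := ℝ) (isPositiveOn_ringMeasure (e := e))
      (Submodule.add_mem _ h1.1 h2.1) (fun x => by
        simp only [RCLike.re_to_real, Pi.add_apply, Finset.sum_apply, Pi.smul_apply, smul_eq_mul]
        rw [← Finset.sum_add_distrib]
        refine (h0 x).trans (Finset.sum_le_sum fun A hA => ?_)
        have hx1 := @hLA A hA x
        have hx2 := @hAU A hA x
        have := abs_nonneg (l A)
        have := le_abs_self (l A)
        have := neg_abs_le (l A)
        by_cases hL : x ∈ L A <;> by_cases hx : x ∈ A <;> by_cases hU : x ∈ U A <;>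
          simp_all
        linarith)
    rw [simpleIntegral_add isPositiveOn_ringMeasure h1.1 h2.1, h1.2, h2.2] at h3
    simp only [RCLike.re_to_real, RCLike.ofReal_real_eq_id, id] at h3
    rw [← Finset.sum_add_distrib] at h3
    rw [hC, Finset.mul_sum, Finset.sum_mul, ← Finset.sum_add_distrib]
    refine h3.trans (Finset.sum_le_sum fun A hA => ?_)
    have hb := shiftMeasure_bounds (hL A hA) (hU A hA) (hLA A hA) (hAU A hA)
    have hd := hlt A hA
    have hs := ringMeasure_sdiff (hL A hA) (hU A hA) ((hLA A hA).trans (hAU A hA))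
    have ha := abs_nonneg (l A)
    have h4 : l A * (ringMeasure e (U A) - shiftMeasure e A) ≤ |l A| * δ := by
      refine (le_abs_self _).trans ?_
      rw [abs_mul]
      refine mul_le_mul_of_nonneg_left ?_ ha
      rw [abs_le]
      constructor <;> linarith
    have h5 : |l A| * ringMeasure e (U A \ L A) ≤ |l A| * δ :=
      mul_le_mul_of_nonneg_left hd.le ha
    rw [smul_eq_mul]
    linarith
  refine le_of_forall_pos_le_add fun ε hε => ?_
  refine (key (ε / (2 * C + 1)) (by positivity)).trans ?_
  gcongr
  rw [mul_div_assoc', div_le_iff₀ (by positivity)]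
  nlinarith

/-! ### The Hilbert space of square integrable functions -/

variable (e) in
/-- The space of finite linear combinations `∑ c_k χ_{B_k}`, `c_k ∈ ℂ`, of characteristic functions
of measurable sets. -/
def SimpleFunctions : Type _ := simpleSpan ℂ (completedRing e)

namespace SimpleFunctions

instance : AddCommGroup (SimpleFunctions e) :=
  inferInstanceAs (AddCommGroup (simpleSpan ℂ (completedRing e)))

instance : Module ℂ (SimpleFunctions e) :=
  inferInstanceAs (Module ℂ (simpleSpan ℂ (completedRing e)))

/-- The underlying function on `E`. -/
def toFun (f : SimpleFunctions e) : E → ℂ := Subtype.val (p := (· ∈ simpleSpan ℂ (completedRing e))) f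

instance : CoeFun (SimpleFunctions e) fun _ => E → ℂ := ⟨toFun⟩

theorem mem (f : SimpleFunctions e) : (f : E → ℂ) ∈ simpleSpan ℂ (completedRing e) := Subtype.prop f

/-- A linear combination of characteristic functions, as a simple function. -/
def mk (f : E → ℂ) (hf : f ∈ simpleSpan ℂ (completedRing e)) : SimpleFunctions e := ⟨f, hf⟩

theorem mk_apply {f : E → ℂ} (hf : f ∈ simpleSpan ℂ (completedRing e)) (x : E) :
    mk f hf x = f x := rfl

theorem add_apply (f g : SimpleFunctions e) (x : E) : (f + g) x = f x + g x := rfl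
theorem sub_apply (f g : SimpleFunctions e) (x : E) : (f - g) x = f x - g x := rfl
theorem smul_apply (c : ℂ) (f : SimpleFunctions e) (x : E) : (c • f) x = c * f x := rfl

end SimpleFunctions

theorem mul_mem {f g : E → ℂ} (hf : f ∈ simpleSpan ℂ (completedRing e))
    (hg : g ∈ simpleSpan ℂ (completedRing e)) : f * g ∈ simpleSpan ℂ (completedRing e) :=
  mul_mem_simpleSpan (fun _ hA _ hB => chi_mem (isSetRing_completedRing.inter_mem hA hB)) hf hg

theorem conj_mul_mem (f g : SimpleFunctions e) :
    (fun x => conj (f x) * g x) ∈ simpleSpan ℂ (completedRing e) :=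
  mul_mem (conj_mem_simpleSpan f.mem) g.mem

variable (e) in
/-- The sesquilinear form `(f, g) = ∫ conj f · g dλ` on simple functions. The corresponding seminorm
of `∑ c_k χ_{B_k}` with pairwise disjoint `B_k` is `(∑ |c_k|² λ(B_k))^{1/2}`. -/
@[reducible] def simpleCore : PreInnerProductSpace.Core ℂ (SimpleFunctions e) where
  inner f g := simpleIntegral ℂ (completedRing e) (shiftMeasure e) fun x => conj (f x) * g x
  conj_inner_symm f g := by
    rw [← simpleIntegral_conj isPositiveOn_shiftMeasure
      (conj_mul_mem g f)]
    congr 1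
    funext x
    simp [mul_comm]
  re_inner_nonneg f := by
    refine simpleIntegral_re_nonneg isPositiveOn_shiftMeasure
      (conj_mul_mem f f) fun x => ?_
    rw [RCLike.conj_mul]
    norm_cast
    positivity
  add_left f g h := by
    rw [← simpleIntegral_add isPositiveOn_shiftMeasure
      (conj_mul_mem f h) (conj_mul_mem g h)]
    congr 1
    funext x
    simp [SimpleFunctions.add_apply, add_mul]
  smul_left f g c := by
    rw [← simpleIntegral_smul isPositiveOn_shiftMeasure _
      (conj_mul_mem f g)]
    congr 1
    funext x
    simp [SimpleFunctions.smul_apply, mul_assoc]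

instance : SeminormedAddCommGroup (SimpleFunctions e) :=
  @InnerProductSpace.Core.toSeminormedAddCommGroup ℂ _ _ _ _ (simpleCore e)

instance : InnerProductSpace ℂ (SimpleFunctions e) := InnerProductSpace.ofCore (simpleCore e)

variable (e) in
/-- The Hilbert space of functions on `E` that are square integrable with respect to the
shift-invariant measure: the (Hausdorff) completion of the space of simple functions. -/
abbrev HilbertE : Type _ := UniformSpace.Completion (SimpleFunctions e)

theorem norm_sq_simple (f : SimpleFunctions e) : ‖f‖ ^ 2 =
    RCLike.re (simpleIntegral ℂ (completedRing e) (shiftMeasure e) fun x => conj (f x) * f x) :=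
  InnerProductSpace.norm_sq_eq_re_inner (𝕜 := ℂ) f

theorem norm_sq_le {f g h : SimpleFunctions e} {a b : ℝ}
    (H : ∀ x, ‖f x‖ ^ 2 ≤ a * ‖g x‖ ^ 2 + b * ‖h x‖ ^ 2) :
    ‖f‖ ^ 2 ≤ a * ‖g‖ ^ 2 + b * ‖h‖ ^ 2 := by
  have hm := isPositiveOn_shiftMeasure (e := e)
  have hr : ∀ r : ℝ, ((r : ℂ) ^ 2).re = r ^ 2 := fun r => by
    rw [← Complex.ofReal_pow, Complex.ofReal_re]
  have h1 := simpleIntegral_re_nonneg hm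
    (Submodule.add_mem _ (Submodule.add_mem _ (Submodule.smul_mem _ (a : ℂ) (conj_mul_mem g g))
      (Submodule.smul_mem _ (b : ℂ) (conj_mul_mem h h)))
      (Submodule.smul_mem _ (-1 : ℂ) (conj_mul_mem f f))) (fun x => by
        simp only [Pi.add_apply, Pi.smul_apply, smul_eq_mul, RCLike.conj_mul]
        have := H x
        norm_cast
        simp only [Complex.coe_algebraMap, RCLike.re_to_complex, Complex.add_re,
          Complex.re_ofReal_mul]
        simp
        simp only [hr]
        linarith)
  rw [simpleIntegral_add hm (Submodule.add_mem _ (Submodule.smul_mem _ (a : ℂ) (conj_mul_mem g g))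
      (Submodule.smul_mem _ (b : ℂ) (conj_mul_mem h h)))
      (Submodule.smul_mem _ (-1 : ℂ) (conj_mul_mem f f)),
    simpleIntegral_add hm (Submodule.smul_mem _ (a : ℂ) (conj_mul_mem g g))
      (Submodule.smul_mem _ (b : ℂ) (conj_mul_mem h h)),
    simpleIntegral_smul hm _ (conj_mul_mem g g), simpleIntegral_smul hm _ (conj_mul_mem h h),
    simpleIntegral_smul hm _ (conj_mul_mem f f)] at h1
  rw [norm_sq_simple f, norm_sq_simple g, norm_sq_simple h]
  simp only [RCLike.re_to_complex, Complex.add_re, Complex.re_ofReal_mul, neg_mul, one_mul,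
    Complex.neg_re] at h1 ⊢
  linarith

theorem norm_chi_sq {A : Set E} (hA : A ∈ completedRing e) :
    ‖SimpleFunctions.mk (chi ℂ A) (chi_mem hA)‖ ^ 2 = shiftMeasure e A := by
  rw [norm_sq_simple]
  have : (fun x => conj (SimpleFunctions.mk (chi ℂ A) (chi_mem hA) x) *
      SimpleFunctions.mk (chi ℂ A) (chi_mem hA) x) = chi ℂ A := by
    funext x
    rw [SimpleFunctions.mk_apply]
    by_cases hx : x ∈ A <;> simp [hx]
  rw [this, simpleIntegral_chi isPositiveOn_shiftMeasure hA]
  simp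

/-! ### Functions as elements of the Hilbert space and multiplication operators -/

/-- The function `f` represents the element `u` of the Hilbert space: `f` can be approximated by
simple functions `s` converging to `u`, with an error dominated by simple functions `w` of
arbitrarily small norm. -/
def Represents (f : E → ℂ) (u : HilbertE e) : Prop :=
  ∀ ε > 0, ∃ s w : SimpleFunctions e,
    (∀ x, ‖f x - s x‖ ≤ (w x).re) ∧ ‖w‖ ≤ ε ∧ ‖u - (s : HilbertE e)‖ ≤ ε

/-- `M` is the operator of multiplication by the function `φ`. -/
def IsMultiplicationBy (φ : E → ℂ) (M : HilbertE e →L[ℂ] HilbertE e) : Prop :=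
  ∀ s : SimpleFunctions e, Represents (fun x => φ x * s x) (M (s : HilbertE e))

variable (e) in
/-- The bounded operator of multiplication by `φ` if there is one, and `0` otherwise; there is one
for bounded continuous functions of finitely many coordinates, see `isMultiplicationBy_mulOp`. -/
def mulOp (φ : E → ℂ) : HilbertE e →L[ℂ] HilbertE e :=
  open Classical in
  if h : ∃ M : HilbertE e →L[ℂ] HilbertE e, IsMultiplicationBy φ M then h.choose else 0

theorem norm_sub_le_of_approx {f : E → ℂ} {s w s' w' : SimpleFunctions e} {ε : ℝ} (hε : 0 ≤ ε)
    (h : ∀ x, ‖f x - s x‖ ≤ (w x).re) (hw : ‖w‖ ≤ ε) (h' : ∀ x, ‖f x - s' x‖ ≤ (w' x).re)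
    (hw' : ‖w'‖ ≤ ε) : ‖s - s'‖ ≤ 2 * ε := by
  have h1 : ‖s - s'‖ ^ 2 ≤ 2 * ‖w‖ ^ 2 + 2 * ‖w'‖ ^ 2 := norm_sq_le fun x => by
    have h2 : ‖(s - s') x‖ ≤ ‖w x‖ + ‖w' x‖ := by
      rw [SimpleFunctions.sub_apply]
      have : s x - s' x = (f x - s' x) - (f x - s x) := by ring
      rw [this]
      have h3 := (h x).trans (Complex.re_le_norm _)
      have h4 := (h' x).trans (Complex.re_le_norm _)
      exact (norm_sub_le _ _).trans (by linarith)
    nlinarith [norm_nonneg ((s - s') x), norm_nonneg (w x), norm_nonneg (w' x),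
      sq_nonneg (‖w x‖ - ‖w' x‖)]
  refine abs_le_of_sq_le_sq' ?_ (by positivity) |>.2
  nlinarith [norm_nonneg w, norm_nonneg w']

theorem Represents.unique {f : E → ℂ} {u v : HilbertE e} (hu : Represents f u)
    (hv : Represents f v) : u = v := by
  rw [← sub_eq_zero, ← norm_le_zero_iff]
  refine le_of_forall_pos_le_add fun ε hε => ?_
  obtain ⟨s, w, h1, h2, h3⟩ := hu (ε / 4) (by positivity)
  obtain ⟨s', w', h1', h2', h3'⟩ := hv (ε / 4) (by positivity)
  have h4 := norm_sub_le_of_approx (by positivity) h1 h2 h1' h2'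
  rw [← UniformSpace.Completion.norm_coe, UniformSpace.Completion.coe_sub] at h4
  have : u - v = (u - (s : HilbertE e)) + ((s : HilbertE e) - s') - (v - s') := by abel
  rw [this]
  refine (norm_sub_le _ _).trans ?_
  have := norm_add_le (u - (s : HilbertE e)) ((s : HilbertE e) - s')
  linarith

theorem Represents.add {f g : E → ℂ} {u v : HilbertE e} (hu : Represents f u)
    (hv : Represents g v) : Represents (fun x => f x + g x) (u + v) := by
  intro ε hε
  obtain ⟨s, w, h1, h2, h3⟩ := hu (ε / 2) (by positivity)
  obtain ⟨s', w', h1', h2', h3'⟩ := hv (ε / 2) (by positivity)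
  refine ⟨s + s', w + w', fun x => ?_, ?_, ?_⟩
  · rw [SimpleFunctions.add_apply, SimpleFunctions.add_apply, Complex.add_re, add_sub_add_comm]
    exact (norm_add_le _ _).trans (add_le_add (h1 x) (h1' x))
  · exact (norm_add_le _ _).trans (by linarith)
  · rw [UniformSpace.Completion.coe_add, add_sub_add_comm]
    exact (norm_add_le _ _).trans (by linarith)

theorem Represents.smul {f : E → ℂ} {u : HilbertE e} (hu : Represents f u) (c : ℂ) :
    Represents (fun x => c * f x) (c • u) := by
  intro ε hε
  have hc : 0 < ‖c‖ + 1 := by positivity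
  obtain ⟨s, w, h1, h2, h3⟩ := hu (ε / (‖c‖ + 1)) (by positivity)
  have hle : ∀ r ≤ ε / (‖c‖ + 1), 0 ≤ r → ‖c‖ * r ≤ ε := fun r hr h0 => by
    rw [le_div_iff₀ hc] at hr
    nlinarith
  refine ⟨c • s, (‖c‖ : ℂ) • w, fun x => ?_, ?_, ?_⟩
  · rw [SimpleFunctions.smul_apply, SimpleFunctions.smul_apply, Complex.re_ofReal_mul, ← mul_sub,
      norm_mul]
    exact mul_le_mul_of_nonneg_left (h1 x) (norm_nonneg c)
  · rw [norm_smul, Complex.norm_real, norm_norm]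
    exact hle _ h2 (norm_nonneg _)
  · rw [UniformSpace.Completion.coe_smul, ← smul_sub, norm_smul]
    exact hle _ h3 (norm_nonneg _)

/-- A function which is approximable by simple functions represents an element. -/
theorem exists_represents {f : E → ℂ} (hf : ∀ ε > 0, ∃ s w : SimpleFunctions e,
    (∀ x, ‖f x - s x‖ ≤ (w x).re) ∧ ‖w‖ ≤ ε) : ∃ u : HilbertE e, Represents f u := by
  have hpos : ∀ n : ℕ, (0 : ℝ) < 1 / (n + 1) := fun n => Nat.one_div_pos_of_nat
  choose s w h hw using fun n : ℕ => hf (1 / (n + 1)) (hpos n)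
  have hlim : Tendsto (fun n : ℕ => 2 * ((1 : ℝ) / (n + 1))) atTop (𝓝 0) := by
    simpa using tendsto_one_div_add_atTop_nhds_zero_nat.const_mul (2 : ℝ)
  have hd : ∀ n m N : ℕ, N ≤ n → N ≤ m →
      dist (s n : HilbertE e) (s m) ≤ 2 * (1 / (N + 1)) := fun n m N hn hm => by
    rw [dist_eq_norm, ← UniformSpace.Completion.coe_sub, UniformSpace.Completion.norm_coe]
    exact norm_sub_le_of_approx (hpos N).le (h n)
      ((hw n).trans (one_div_le_one_div_of_le (by positivity) (by gcongr))) (h m)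
      ((hw m).trans (one_div_le_one_div_of_le (by positivity) (by gcongr)))
  obtain ⟨u, hu⟩ := cauchySeq_tendsto_of_complete (cauchySeq_of_le_tendsto_0 _ hd hlim)
  refine ⟨u, fun ε hε => ?_⟩
  have h1 := (hlim.eventually (gt_mem_nhds hε)).and
    ((tendsto_iff_norm_sub_tendsto_zero.1 hu).eventually (gt_mem_nhds hε))
  obtain ⟨n, hn1, hn2⟩ := h1.exists
  refine ⟨s n, w n, h n, (hw n).trans ?_, ?_⟩
  · linarith [hpos n]
  · rw [norm_sub_rev]; exact hn2.le

theorem Represents.approx {f : E → ℂ} {u : HilbertE e} (hu : Represents f u) :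
    ∀ ε > 0, ∃ s w : SimpleFunctions e, (∀ x, ‖f x - s x‖ ≤ (w x).re) ∧ ‖w‖ ≤ ε := fun ε hε =>
  let ⟨s, w, h1, h2, _⟩ := hu ε hε
  ⟨s, w, h1, h2⟩

theorem IsMultiplicationBy.unique {φ : E → ℂ} {M N : HilbertE e →L[ℂ] HilbertE e}
    (hM : IsMultiplicationBy φ M) (hN : IsMultiplicationBy φ N) : M = N := by
  ext u
  induction u using UniformSpace.Completion.induction_on with
  | hp => exact isClosed_eq M.continuous N.continuous
  | ih s => exact (hM s).unique (hN s)

/-- A bounded function `φ` such that every `φ s`, `s` simple, represents an element of the Hilbert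
space is a multiplier. -/
theorem exists_isMultiplicationBy {φ : E → ℂ} {C : ℝ} (hC : ∀ x, ‖φ x‖ ≤ C)
    (hφ : ∀ s : SimpleFunctions e, ∃ u : HilbertE e, Represents (fun x => φ x * s x) u) :
    ∃ M : HilbertE e →L[ℂ] HilbertE e, IsMultiplicationBy φ M := by
  choose u hu using hφ
  let T : SimpleFunctions e →ₗ[ℂ] HilbertE e :=
    { toFun := u
      map_add' := fun s t => (hu (s + t)).unique (by
        convert (hu s).add (hu t) using 2 with x
        rw [SimpleFunctions.add_apply, mul_add])
      map_smul' := fun c s => (hu (c • s)).unique (by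
        rw [RingHom.id_apply]
        convert (hu s).smul c using 2 with x
        rw [SimpleFunctions.smul_apply]
        ring) }
  let ι : SimpleFunctions e →ₗ[ℂ] HilbertE e :=
    (UniformSpace.Completion.toComplL (𝕜 := ℂ) (E := SimpleFunctions e)).toLinearMap
  have hι : ∀ s : SimpleFunctions e, ι s = (s : HilbertE e) := fun s => rfl
  have hC0 : 0 ≤ C := (norm_nonneg (φ 0)).trans (hC 0)
  have hT : ∀ s, ‖T s‖ ≤ (2 * C) * ‖ι s‖ := by
    intro s
    rw [hι, UniformSpace.Completion.norm_coe]
    refine le_of_forall_pos_le_add fun ε hε => ?_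
    obtain ⟨t, w, h1, h2, h3⟩ := hu s (ε / 3) (by positivity)
    have h4 : ‖t‖ ^ 2 ≤ (2 * C ^ 2) * ‖s‖ ^ 2 + 2 * ‖w‖ ^ 2 := norm_sq_le fun x => by
      have h5 : ‖t x‖ ≤ C * ‖s x‖ + ‖w x‖ := by
        have h6 : t x = φ x * s x - (φ x * s x - t x) := by ring
        rw [h6]
        refine (norm_sub_le _ _).trans (add_le_add ?_ ((h1 x).trans (Complex.re_le_norm _)))
        rw [norm_mul]
        exact mul_le_mul_of_nonneg_right (hC x) (norm_nonneg _)
      nlinarith [norm_nonneg (t x), norm_nonneg (s x), norm_nonneg (w x),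
        sq_nonneg (C * ‖s x‖ - ‖w x‖), mul_nonneg hC0 (norm_nonneg (s x))]
    have h5 : ‖t‖ ≤ 2 * C * ‖s‖ + 2 * ‖w‖ := by
      refine abs_le_of_sq_le_sq' ?_ (by positivity) |>.2
      nlinarith [mul_nonneg (mul_nonneg hC0 (norm_nonneg s)) (norm_nonneg w), sq_nonneg (C * ‖s‖),
        norm_nonneg w]
    have h6 : ‖T s‖ ≤ ‖t‖ + ε / 3 := by
      have h7 : T s = (t : HilbertE e) + (u s - t) := by
        rw [add_sub_cancel]; rfl
      rw [h7]
      refine (norm_add_le _ _).trans ?_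
      rw [UniformSpace.Completion.norm_coe]
      linarith
    linarith
  refine ⟨T.extendOfNorm ι, fun s => ?_⟩
  rw [← hι, LinearMap.extendOfNorm_eq (UniformSpace.Completion.denseRange_coe) ⟨_, hT⟩]
  exact hu s

theorem block_box (a b : ℕ → ℝ) (n : ℕ) (y : Fin n → ℝ) (δ : ℝ) (x : E) :
    x ∈ block e a b ∩ block e (fun j => if h : j < n then y ⟨j, h⟩ - δ else a j)
      (fun j => if h : j < n then y ⟨j, h⟩ + δ else b j) ↔
    x ∈ block e a b ∧ ∀ k : Fin n, coord e k x ∈ Ico (y k - δ) (y k + δ) := by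
  refine and_congr_right fun hx => ⟨fun h k => ?_, fun h j => ?_⟩
  · simpa using h k
  · by_cases hj : j < n
    · simpa [hj] using h ⟨j, hj⟩
    · simpa [hj] using hx j

/-- A continuous function of finitely many coordinates, restricted to a block, represents an element
of the Hilbert space. -/
theorem exists_represents_block {n : ℕ} {g : (Fin n → ℝ) → ℂ} (hg : Continuous g) {Q : Set E}
    (hQ : IsMeasurableBlock e Q) :
    ∃ u : HilbertE e, Represents (fun x => g (fun k => coord e k x) * chi ℂ Q x) u := by
  refine exists_represents fun ε hε => ?_
  have hR := isSetRing_blockRing (e := e)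
  have hQc := blockRing_subset_completedRing (block_mem_blockRing hQ)
  set c : ℝ := ε / (‖SimpleFunctions.mk (chi ℂ Q) (chi_mem hQc)‖ + 1) with hc
  have hc0 : 0 < c := by positivity
  obtain ⟨a, b, ⟨M, hM⟩, hab, rfl, -⟩ := id hQ
  let π : E → Fin n → ℝ := fun x k => coord e k x
  let K : Set (Fin n → ℝ) := Icc (fun k => a k) (fun k => b k)
  have key : ∃ A ∈ completedRing e, block e a b ∩ π ⁻¹' K ⊆ A ∧ A ⊆ block e a b ∧
      ∃ s : SimpleFunctions e, ∀ x, ‖g (π x) * chi ℂ A x - s x‖ ≤ c * chi ℝ A x := by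
    refine (isCompact_Icc (a := fun k : Fin n => a k) (b := fun k : Fin n => b k)).induction_on
      (p := fun T => ∃ A ∈ completedRing e, block e a b ∩ π ⁻¹' T ⊆ A ∧ A ⊆ block e a b ∧
      ∃ s : SimpleFunctions e, ∀ x, ‖g (π x) * chi ℂ A x - s x‖ ≤ c * chi ℝ A x) ?_ ?_ ?_ ?_
    · refine ⟨∅, isSetRing_completedRing.empty_mem, by simp, empty_subset _, 0, fun x => ?_⟩
      have : (0 : SimpleFunctions e) x = 0 := rfl
      simp [this]
    · rintro T T' hTT' ⟨A, hA, h1, h2⟩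
      exact ⟨A, hA, (inter_subset_inter_right _ (preimage_mono hTT')).trans h1, h2⟩
    · rintro T T' ⟨A, hA, h1, h2, s, hs⟩ ⟨A', hA', h1', h2', s', hs'⟩
      have hd := isSetRing_completedRing.sdiff_mem hA' hA
      refine ⟨A ∪ A', isSetRing_completedRing.union_mem hA hA', ?_, union_subset h2 h2',
        s + SimpleFunctions.mk _ (mul_mem (chi_mem hd) s'.mem), fun x => ?_⟩
      · rintro x ⟨hx, hx' | hx'⟩
        · exact Or.inl (h1 ⟨hx, hx'⟩)
        · exact Or.inr (h1' ⟨hx, hx'⟩)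
      · rw [SimpleFunctions.add_apply, SimpleFunctions.mk_apply]
        have h3 := hs x
        have h4 := hs' x
        by_cases hx : x ∈ A
        · simpa [hx] using h3
        · by_cases hx' : x ∈ A'
          · have h5 : s x = 0 := by simpa [hx] using h3
            simpa [hx, hx', h5] using h4
          · have h5 : s x = 0 := by simpa [hx] using h3
            simp [hx, hx', h5]
    · intro y _
      obtain ⟨δ, hδ, hδg⟩ := Metric.continuous_iff.1 hg y c hc0
      set W := block e (fun j => if h : j < n then y ⟨j, h⟩ - δ / 2 else a j)
        (fun j => if h : j < n then y ⟨j, h⟩ + δ / 2 else b j) with hW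
      have hbd : ∃ N, ∀ j, |if h : j < n then y ⟨j, h⟩ - δ / 2 else a j| ≤ N ∧
          |if h : j < n then y ⟨j, h⟩ + δ / 2 else b j| ≤ N := by
        have hy : ∀ k, |y k| ≤ ‖y‖ := fun k => norm_le_pi_norm y k
        have hM0 : 0 ≤ M := (abs_nonneg _).trans (hM 0).1
        refine ⟨M + ‖y‖ + δ, fun j => ?_⟩
        have := norm_nonneg y
        by_cases hj : j < n
        · have h1 := abs_le.1 (hy ⟨j, hj⟩)
          simp only [hj, dif_pos, abs_le]
          refine ⟨⟨?_, ?_⟩, ?_, ?_⟩ <;> linarith [h1.1, h1.2]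
        · simp only [hj, dif_neg, not_false_eq_true]
          exact ⟨(hM j).1.trans (by linarith), (hM j).2.trans (by linarith)⟩
      have hA : block e a b ∩ W ∈ completedRing e := by
        rcases hQ.inter_block hbd with h | h
        · rw [h]; exact isSetRing_completedRing.empty_mem
        · exact blockRing_subset_completedRing (block_mem_blockRing h)
      refine ⟨Metric.ball y (δ / 2),
        mem_nhdsWithin_of_mem_nhds (Metric.ball_mem_nhds _ (by positivity)),
        block e a b ∩ W, hA, ?_, inter_subset_left, g y • SimpleFunctions.mk _ (chi_mem hA), ?_⟩
      · rintro x ⟨hx, hx'⟩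
        refine (block_box a b n y (δ / 2) x).2 ⟨hx, fun k => ?_⟩
        have h1 : |coord e k x - y k| < δ / 2 :=
          (dist_le_pi_dist (π x) y k).trans_lt hx'
        rw [abs_lt] at h1
        exact ⟨by linarith [h1.1], by linarith [h1.2]⟩
      · intro x
        rw [SimpleFunctions.smul_apply, SimpleFunctions.mk_apply]
        by_cases hx : x ∈ block e a b ∩ W
        · have h1 := (block_box a b n y (δ / 2) x).1 hx
          have h2 : dist (π x) y < δ := by
            refine lt_of_le_of_lt ((dist_pi_le_iff (by positivity)).2 fun k => ?_)
              (half_lt_self hδ)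
            rw [Real.dist_eq, abs_le]
            exact ⟨by linarith [(h1.2 k).1], by linarith [(h1.2 k).2]⟩
          have h3 := hδg (π x) h2
          rw [dist_eq_norm] at h3
          simpa [chi, indicator_of_mem hx] using h3.le
        · simp [chi, indicator_of_notMem hx]
  obtain ⟨A, hA, h1, h2, s, hs⟩ := key
  have hAQ : A = block e a b := by
    refine h2.antisymm fun x hx => h1 ⟨hx, ?_, ?_⟩
    · exact fun k => (hx k).1
    · exact fun k => (hx k).2.le
  subst hAQ
  refine ⟨s, (c : ℂ) • SimpleFunctions.mk _ (chi_mem hQc), fun x => ?_, ?_⟩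
  · refine (hs x).trans_eq ?_
    rw [SimpleFunctions.smul_apply, SimpleFunctions.mk_apply, Complex.re_ofReal_mul]
    by_cases hx : x ∈ block e a b <;> simp [hx]
  · rw [norm_smul, Complex.norm_real, Real.norm_of_nonneg hc0.le, hc, div_mul_eq_mul_div,
      div_le_iff₀ (by positivity)]
    gcongr
    linarith

/-- Bounded continuous functions of finitely many coordinates are multipliers. -/
theorem isMultiplicationBy_mulOp {n : ℕ} {g : (Fin n → ℝ) → ℂ} (hg : Continuous g) {C : ℝ}
    (hC : ∀ y, ‖g y‖ ≤ C) :
    IsMultiplicationBy (fun x => g fun k => coord e k x)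
      (mulOp e fun x => g fun k => coord e k x) := by
  have hC0 : 0 ≤ C := (norm_nonneg _).trans (hC 0)
  have hspan : ∀ {S : Set (Set E)}, (∀ A ∈ S, ∃ u : HilbertE e,
      Represents (fun x => g (fun k => coord e k x) * chi ℂ A x) u) → ∀ f ∈ simpleSpan ℂ S,
      ∃ u : HilbertE e, Represents (fun x => g (fun k => coord e k x) * f x) u := by
    intro S hS f hf
    induction hf using Submodule.span_induction with
    | mem f h =>
      obtain ⟨A, hA, rfl⟩ := h
      exact hS A hA
    | zero =>
      refine ⟨0, fun ε hε => ⟨0, 0, fun x => ?_, by simpa using hε.le, by simpa using hε.le⟩⟩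
      have : (0 : SimpleFunctions e) x = 0 := rfl
      simp [this]
    | add f h _ _ hf hh =>
      obtain ⟨u, hu⟩ := hf
      obtain ⟨v, hv⟩ := hh
      refine ⟨u + v, ?_⟩
      convert hu.add hv using 2 with x
      rw [Pi.add_apply, mul_add]
    | smul c f _ hf =>
      obtain ⟨u, hu⟩ := hf
      refine ⟨c • u, ?_⟩
      convert hu.smul c using 2 with x
      rw [Pi.smul_apply, smul_eq_mul]
      ring
  have hblock := hspan (S := {Q | IsMeasurableBlock e Q})
    fun Q hQ => exists_represents_block hg hQ
  have h : ∃ M : HilbertE e →L[ℂ] HilbertE e,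
      IsMultiplicationBy (fun x => g fun k => coord e k x) M := by
    refine exists_isMultiplicationBy (C := C) (fun x => hC _) fun s => hspan (fun B hB => ?_) s s.mem
    refine exists_represents fun ε hε => ?_
    obtain ⟨L, hL, U, hU, hLB, hBU, hlt⟩ := hB ((ε / (2 * (C + 1))) ^ 2) (by positivity)
    obtain ⟨u, hu⟩ := hblock _ (chi_mem_of_mem_blockRing ℂ hL)
    obtain ⟨t, w, h1, h2⟩ := hu.approx (ε / 2) (by positivity)
    have hd := isSetRing_blockRing.sdiff_mem hU hL
    have hdc := blockRing_subset_completedRing hd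
    refine ⟨t, w + (C : ℂ) • SimpleFunctions.mk _ (chi_mem hdc), fun x => ?_, ?_⟩
    · rw [SimpleFunctions.add_apply, SimpleFunctions.smul_apply, SimpleFunctions.mk_apply,
        Complex.add_re, Complex.re_ofReal_mul]
      have h3 := h1 x
      have h4 : ‖g (fun k => coord e k x) * chi ℂ B x - g (fun k => coord e k x) * chi ℂ L x‖ ≤
          C * (chi ℂ (U \ L) x).re := by
        have h5 := @hLB x
        have h6 := @hBU x
        have h7 := hC fun k => coord e k x
        by_cases hL : x ∈ L <;> by_cases hx : x ∈ B <;> by_cases hU : x ∈ U <;> simp_all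
      have h5 : g (fun k => coord e k x) * chi ℂ B x - t x =
          (g (fun k => coord e k x) * chi ℂ L x - t x) +
          (g (fun k => coord e k x) * chi ℂ B x - g (fun k => coord e k x) * chi ℂ L x) := by ring
      rw [h5]
      exact (norm_add_le _ _).trans (add_le_add h3 h4)
    · have h3 : ‖SimpleFunctions.mk _ (chi_mem hdc)‖ ≤ ε / (2 * (C + 1)) := by
        refine abs_le_of_sq_le_sq' ?_ (by positivity) |>.2
        rw [norm_chi_sq hdc, shiftMeasure_eq_ringMeasure hd]
        exact hlt.le
      refine (norm_add_le _ _).trans ?_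
      rw [norm_smul, Complex.norm_real, Real.norm_of_nonneg hC0]
      have h4 : C * ‖SimpleFunctions.mk _ (chi_mem hdc)‖ ≤ ε / 2 := by
        refine (mul_le_mul_of_nonneg_left h3 hC0).trans ?_
        rw [mul_div_assoc', div_le_div_iff₀ (by positivity) (by positivity)]
        nlinarith
      linarith
  rw [mulOp, dif_pos h]
  exact h.choose_spec

/-! ### Momentum shifts and their Gaussian averages -/

variable (e) in
/-- The shift in the momentum representation by the vector `h = ∑_{k < n} y_k e_k`, i.e. the operator
of multiplication by `exp(i (h, x))`. -/
def momentumShift (n : ℕ) (y : Fin n → ℝ) : HilbertE e →L[ℂ] HilbertE e :=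
  mulOp e fun x => Complex.exp (Complex.I * ((∑ k : Fin n, y k * coord e k x : ℝ) : ℂ))

variable (e) in
/-- The momentum averaging operator `Û_{tD_n}`, where `D` is diagonal in the basis `e` with the
eigenvalues `d_k` and `D_n = D P_n`: the operator of multiplication by
`exp(- t ∑_{k < n} d_k x_k² / 2)`. -/
def momentumAveraging (d : ℕ → ℝ) (n : ℕ) (t : ℝ) : HilbertE e →L[ℂ] HilbertE e :=
  mulOp e fun x => ((Real.exp (-(t * ∑ k : Fin n, d k * coord e k x ^ 2 / 2)) : ℝ) : ℂ)

theorem isMultiplicationBy_momentumShift (n : ℕ) (y : Fin n → ℝ) :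
    IsMultiplicationBy
      (fun x => Complex.exp (Complex.I * ((∑ k : Fin n, y k * coord e k x : ℝ) : ℂ)))
      (momentumShift e n y) :=
  isMultiplicationBy_mulOp (e := e) (C := 1)
    (g := fun z : Fin n → ℝ => Complex.exp (Complex.I * ((∑ k : Fin n, y k * z k : ℝ) : ℂ)))
    (by fun_prop) fun z => by rw [mul_comm, Complex.norm_exp_ofReal_mul_I]

theorem isMultiplicationBy_momentumAveraging {d : ℕ → ℝ} (hd : ∀ k, 0 ≤ d k) (n : ℕ) {t : ℝ}
    (ht : 0 ≤ t) :
    IsMultiplicationBy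
      (fun x => ((Real.exp (-(t * ∑ k : Fin n, d k * coord e k x ^ 2 / 2)) : ℝ) : ℂ))
      (momentumAveraging e d n t) :=
  isMultiplicationBy_mulOp (e := e) (C := 1)
    (g := fun z : Fin n → ℝ => ((Real.exp (-(t * ∑ k : Fin n, d k * z k ^ 2 / 2)) : ℝ) : ℂ))
    (by fun_prop) fun z => by
      rw [Complex.norm_real, Real.norm_of_nonneg (Real.exp_pos _).le, Real.exp_le_one_iff,
        neg_nonpos]
      exact mul_nonneg ht (Finset.sum_nonneg fun k _ => div_nonneg
        (mul_nonneg (hd k) (sq_nonneg _)) zero_le_two)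

/-- The centered Gaussian measure with covariance operator `t D_n`, where `D_n e_k = d_k e_k` for
`k < n` and `D_n e_k = 0` otherwise, on the span of the first `n` basis vectors (in coordinates). -/
def gaussianMomentum (d : ℕ → ℝ) (n : ℕ) (t : ℝ) : Measure (Fin n → ℝ) :=
  Measure.pi fun k : Fin n => ProbabilityTheory.gaussianReal 0 (t * d k).toNNReal

end Blocks

/-- A nuclear operator on a real Hilbert space: `D z = ∑ (x_n, z) y_n` with
`∑ ‖x_n‖ ‖y_n‖ < ∞`. -/
def IsNuclear {E : Type*} [NormedAddCommGroup E] [InnerProductSpace ℝ E] (D : E →L[ℝ] E) : Prop :=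
  ∃ x y : ℕ → E, Summable (fun n => ‖x n‖ * ‖y n‖) ∧
    ∀ z, HasSum (fun n => inner ℝ (x n) z • y n) (D z)

/-- `A t`, `t ≥ 0`, is a strongly continuous one-parameter semigroup of bounded operators. -/
structure IsStronglyContinuousSemigroup {H : Type*} [NormedAddCommGroup H] [NormedSpace ℂ H]
    (A : ℝ → H →L[ℂ] H) : Prop where
  map_zero : A 0 = ContinuousLinearMap.id ℂ H
  map_add : ∀ s t, 0 ≤ s → 0 ≤ t → A (s + t) = (A s).comp (A t)
  continuousOn : ∀ f, ContinuousOn (fun t => A t f) (Ici 0)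

end MomentumAveraging

end

/-!
# Strong convergence of momentum averaging operators

All operators in question are multiplications by bounded functions, so they are bounded on the
Hilbert space uniformly (`IsMultiplicationBy.norm_apply_le`), and limits only have to be taken on a
total set: the characteristic functions `χ_Q` of absolutely measurable blocks
(`HilbertE.induction_block`, `tendsto_zero_of_block`).

A block has uniformly bounded edges, so there is `C` with `x_k² ≤ C` for all `x ∈ Q` and all `k`.
Since `D` is nuclear, its eigenvalues `d_k` are summable (`IsNuclear.summable_eigenvalues`), hence
the forms `∑_{k < n} d_k x_k² / 2` converge uniformly on `Q`, with an error of at most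
`C ∑_{k ≥ n} d_k`. This is why nuclearity of `D`, and not of its square root, is enough. As
`|exp(-a) - exp(-b)| ≤ |a - b|` for `a, b ≥ 0`, the operators `Û_{tD_n}` are uniformly Cauchy for
`t ∈ [0, T]` on `χ_Q`, and so on every vector (`uniformCauchySeqOn_momentumAveraging`). The semigroup
law and the continuity in `t` hold for each `n` and pass to the limit (`exists_semigroup`).

To write `Û_{tD_n}` as the Gaussian average of the shifts, the finitely additive integral has to be
exchanged with a Gaussian one. On `χ_Q` this is achieved by a bounded linear map `h ↦ h χ_Q` from
the continuous functions on a compact box in `ℝ^n` that contains the projection of `Q`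
(`exists_blockMultiplication`): it commutes with the Bochner integral of the characters
`exp(i (y, ·))`, which is computed pointwise and equals the Fourier transform of the Gaussian
measure (`momentumAveraging_apply_eq_integral`).
-/

noncomputable section

open Set Filter Topology MeasureTheory
open scoped ComplexConjugate

namespace MomentumAveraging

variable {E : Type*} [NormedAddCommGroup E] [InnerProductSpace ℝ E] {e : HilbertBasis ℕ ℝ E}

/-! ### Multiplication operators -/

theorem Represents.sub {f g : E → ℂ} {u v : HilbertE e} (hu : Represents f u)
    (hv : Represents g v) : Represents (fun x => f x - g x) (u - v) := by
  convert hu.add (hv.smul (-1)) using 1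
  · funext x
    ring
  · module

theorem Represents.norm_le {f : E → ℂ} {u : HilbertE e} (hu : Represents f u)
    {s : SimpleFunctions e} {c : ℝ} (hc : 0 ≤ c) (h : ∀ x, ‖f x‖ ≤ c * ‖s x‖) :
    ‖u‖ ≤ 2 * c * ‖s‖ := by
  refine le_of_forall_pos_le_add fun ε hε => ?_
  obtain ⟨t, w, h1, h2, h3⟩ := hu (ε / 3) (by positivity)
  have h4 : ‖t‖ ^ 2 ≤ (2 * c ^ 2) * ‖s‖ ^ 2 + 2 * ‖w‖ ^ 2 := norm_sq_le fun x => by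
    have h5 : ‖t x‖ ≤ c * ‖s x‖ + ‖w x‖ := by
      rw [← sub_sub_cancel (f x) (t x)]
      exact (norm_sub_le _ _).trans (add_le_add (h x) ((h1 x).trans (Complex.re_le_norm _)))
    nlinarith [norm_nonneg (t x), sq_nonneg (c * ‖s x‖ - ‖w x‖)]
  have h5 : ‖t‖ ≤ 2 * c * ‖s‖ + 2 * ‖w‖ := by
    refine abs_le_of_sq_le_sq' ?_ (by positivity) |>.2
    nlinarith [mul_nonneg (mul_nonneg hc (norm_nonneg s)) (norm_nonneg w), sq_nonneg (c * ‖s‖),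
      norm_nonneg w]
  have h6 : ‖u‖ ≤ ‖t‖ + ε / 3 := by
    rw [← add_sub_cancel (t : HilbertE e) u, ← UniformSpace.Completion.norm_coe t]
    exact (norm_add_le _ _).trans (by gcongr)
  linarith

theorem IsMultiplicationBy.norm_apply_le {φ : E → ℂ} {M : HilbertE e →L[ℂ] HilbertE e}
    (hM : IsMultiplicationBy φ M) {C : ℝ} (hC : ∀ x, ‖φ x‖ ≤ C) (u : HilbertE e) :
    ‖M u‖ ≤ 2 * C * ‖u‖ := by
  have hC0 : 0 ≤ C := (norm_nonneg (φ 0)).trans (hC 0)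
  induction u using UniformSpace.Completion.induction_on with
  | hp => exact isClosed_le (by fun_prop) (by fun_prop)
  | ih s =>
    rw [UniformSpace.Completion.norm_coe]
    refine (hM s).norm_le hC0 fun x => ?_
    rw [norm_mul]
    exact mul_le_mul_of_nonneg_right (hC x) (norm_nonneg _)

theorem IsMultiplicationBy.sub {φ ψ : E → ℂ} {M N : HilbertE e →L[ℂ] HilbertE e}
    (hM : IsMultiplicationBy φ M) (hN : IsMultiplicationBy ψ N) :
    IsMultiplicationBy (fun x => φ x - ψ x) (M - N) := fun s => by
  rw [sub_apply]
  convert (hM s).sub (hN s) using 2 with x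
  ring

theorem IsMultiplicationBy.comp {φ ψ : E → ℂ} {M N : HilbertE e →L[ℂ] HilbertE e}
    (hM : IsMultiplicationBy φ M) (hN : IsMultiplicationBy ψ N) {C : ℝ} (hC : ∀ x, ‖φ x‖ ≤ C) :
    IsMultiplicationBy (fun x => φ x * ψ x) (M.comp N) := fun s ε hε => by
  have hC0 : 0 ≤ C := (norm_nonneg (φ 0)).trans (hC 0)
  set δ := ε / (2 * (2 * C + 1)) with hδ
  have hδ0 : 0 < δ := by positivity
  have hδε : 2 * C * δ + δ = ε / 2 := by rw [hδ]; field_simp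
  obtain ⟨t, w, h1, h2, h3⟩ := hN s δ hδ0
  obtain ⟨t', w', h1', h2', h3'⟩ := hM t (ε / 2) (by positivity)
  refine ⟨t', w' + (C : ℂ) • w, fun x => ?_, ?_, ?_⟩
  · rw [SimpleFunctions.add_apply, SimpleFunctions.smul_apply, Complex.add_re,
      Complex.re_ofReal_mul]
    have h4 : φ x * ψ x * s x - t' x = (φ x * t x - t' x) + φ x * (ψ x * s x - t x) := by ring
    rw [h4]
    refine (norm_add_le _ _).trans (add_le_add (h1' x) ?_)
    rw [norm_mul]
    exact mul_le_mul (hC x) (h1 x) (norm_nonneg _) hC0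
  · refine (norm_add_le _ _).trans ?_
    rw [norm_smul, Complex.norm_real, Real.norm_of_nonneg hC0]
    nlinarith
  · have h4 := hM.norm_apply_le hC (N s - t)
    have h5 : (M.comp N) (s : HilbertE e) - t' = M (N s - t) + (M t - t') := by
      rw [map_sub, ContinuousLinearMap.comp_apply]
      abel
    rw [h5]
    refine (norm_add_le _ _).trans ?_
    nlinarith

theorem isMultiplicationBy_id :
    IsMultiplicationBy (fun _ => 1) (ContinuousLinearMap.id ℂ (HilbertE e)) := fun s ε hε =>
  ⟨s, 0, fun x => by
    have : (0 : SimpleFunctions e) x = 0 := rfl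
    simp [this], by simpa using hε.le, by simpa using hε.le⟩

/-! ### Characteristic functions of blocks -/

/-- The characteristic function of an absolutely measurable block as an element of the Hilbert
space. -/
def blockVec {Q : Set E} (hQ : IsMeasurableBlock e Q) : SimpleFunctions e :=
  SimpleFunctions.mk (chi ℂ Q)
    (chi_mem (blockRing_subset_completedRing (block_mem_blockRing hQ)))

theorem IsMultiplicationBy.norm_apply_blockVec_le {φ : E → ℂ} {M : HilbertE e →L[ℂ] HilbertE e}
    (hM : IsMultiplicationBy φ M) {Q : Set E} (hQ : IsMeasurableBlock e Q) {c : ℝ} (hc : 0 ≤ c)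
    (h : ∀ x ∈ Q, ‖φ x‖ ≤ c) : ‖M (blockVec hQ : HilbertE e)‖ ≤ 2 * c * ‖blockVec hQ‖ := by
  refine (hM _).norm_le hc fun x => ?_
  rw [norm_mul, blockVec, SimpleFunctions.mk_apply]
  by_cases hx : x ∈ Q
  · simpa [hx] using h x hx
  · simp [hx]

/-- The blocks span a dense subspace, so a closed linear condition only has to be checked on them. -/
theorem HilbertE.induction_block {p : HilbertE e → Prop} (hp : IsClosed {f | p f})
    (hadd : ∀ f g, p f → p g → p (f + g)) (hsmul : ∀ (c : ℂ) f, p f → p (c • f))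
    (hblock : ∀ (Q : Set E) (hQ : IsMeasurableBlock e Q), p (blockVec hQ : HilbertE e))
    (f : HilbertE e) : p f := by
  have h0 : p 0 := by
    -- the empty set is a block, with all edges `[1, 2)`
    have hQ : IsMeasurableBlock e (∅ : Set E) := by
      refine ⟨fun _ => 1, fun _ => 2, ⟨2, fun _ => by norm_num⟩, fun _ => by norm_num, ?_,
        Or.inl rfl⟩
      refine (eq_empty_of_forall_notMem fun x hx => ?_).symm
      have h1 := (summable_coord_sq (e := e) x).tendsto_atTop_zero
      have h2 : ∀ j, (1 : ℝ) ≤ coord e j x ^ 2 := fun j => one_le_pow₀ (hx j).1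
      linarith [ge_of_tendsto' h1 h2]
    simpa using hsmul 0 _ (hblock ∅ hQ)
  -- used twice below: `S` is the family of blocks, to reach sets of the ring, and then the
  -- completed ring itself, to reach all simple functions
  have hspan : ∀ {S : Set (Set E)}, S ⊆ completedRing e →
      (∀ A ∈ S, ∀ hA : chi ℂ A ∈ simpleSpan ℂ (completedRing e),
        p (SimpleFunctions.mk _ hA : HilbertE e)) →
      ∀ f ∈ simpleSpan ℂ S, ∀ hf : f ∈ simpleSpan ℂ (completedRing e),
        p (SimpleFunctions.mk f hf : HilbertE e) := by
    intro S hS h f hf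
    have hle : simpleSpan ℂ S ≤ simpleSpan ℂ (completedRing e) :=
      Submodule.span_mono (image_mono hS)
    induction hf using Submodule.span_induction with
    | mem f h' =>
      obtain ⟨A, hA, rfl⟩ := h'
      exact h A hA
    | zero =>
      intro hf
      have : SimpleFunctions.mk (0 : E → ℂ) hf = 0 := rfl
      rw [this, UniformSpace.Completion.coe_zero]
      exact h0
    | add f g hf hg ihf ihg =>
      intro hfg
      have : SimpleFunctions.mk (f + g) hfg =
        SimpleFunctions.mk f (hle hf) + SimpleFunctions.mk g (hle hg) := rfl
      rw [this, UniformSpace.Completion.coe_add]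
      exact hadd _ _ (ihf _) (ihg _)
    | smul c f hf ihf =>
      intro hcf
      have : SimpleFunctions.mk (c • f) hcf = c • SimpleFunctions.mk f (hle hf) := rfl
      rw [this, UniformSpace.Completion.coe_smul]
      exact hsmul _ _ (ihf _)
  induction f using UniformSpace.Completion.induction_on with
  | hp => exact hp
  | ih s =>
    refine hspan subset_rfl (fun B hB hBm => ?_) s s.mem s.mem
    refine hp.closure_subset (Metric.mem_closure_iff.2 fun ε hε => ?_)
    obtain ⟨L, hL, U, hU, hLB, hBU, hlt⟩ := hB (ε ^ 2) (by positivity)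
    have hLc := blockRing_subset_completedRing hL
    have hd := isSetRing_blockRing.sdiff_mem hU hL
    have hdc := blockRing_subset_completedRing hd
    refine ⟨(SimpleFunctions.mk (chi ℂ L) (chi_mem hLc) : HilbertE e),
      hspan (S := {Q | IsMeasurableBlock e Q})
        (fun Q hQ => blockRing_subset_completedRing (block_mem_blockRing hQ))
        (fun Q hQ _ => hblock Q hQ) _ (chi_mem_of_mem_blockRing ℂ hL) _, ?_⟩
    rw [dist_eq_norm, ← UniformSpace.Completion.coe_sub, UniformSpace.Completion.norm_coe]
    refine lt_of_pow_lt_pow_left₀ 2 hε.le (lt_of_le_of_lt ?_ hlt)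
    rw [← shiftMeasure_eq_ringMeasure hd, ← norm_chi_sq hdc]
    have h1 := norm_sq_le (f := SimpleFunctions.mk _ hBm - SimpleFunctions.mk _ (chi_mem hLc))
      (g := SimpleFunctions.mk _ (chi_mem hdc)) (h := 0) (a := 1) (b := 0) fun x => by
        rw [SimpleFunctions.sub_apply, SimpleFunctions.mk_apply, SimpleFunctions.mk_apply,
          SimpleFunctions.mk_apply]
        have h5 := @hLB x
        have h6 := @hBU x
        by_cases hL : x ∈ L <;> by_cases hx : x ∈ B <;> by_cases hU : x ∈ U <;> simp_all
    simpa using h1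

/-- For an eventually bounded family of operators, convergence to zero only has to be checked on
the characteristic functions of blocks. -/
theorem tendsto_zero_of_block {ι : Type*} {l : Filter ι} {F : ι → HilbertE e →L[ℂ] HilbertE e}
    {C : ℝ} (hC : ∀ᶠ i in l, ∀ f, ‖F i f‖ ≤ C * ‖f‖)
    (hF : ∀ (Q : Set E) (hQ : IsMeasurableBlock e Q),
      Tendsto (fun i => F i (blockVec hQ : HilbertE e)) l (𝓝 0)) (f : HilbertE e) :
    Tendsto (fun i => F i f) l (𝓝 0) := by
  refine HilbertE.induction_block (p := fun f => Tendsto (fun i => F i f) l (𝓝 0)) ?_ ?_ ?_ hF f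
  · refine isClosed_of_closure_subset fun f hf => ?_
    rw [mem_ofPred_eq, tendsto_zero_iff_norm_tendsto_zero, Metric.tendsto_nhds]
    intro ε hε
    obtain ⟨g, hg, hfg⟩ := Metric.mem_closure_iff.1 hf (ε / (2 * (|C| + 1))) (by positivity)
    have h1 := (tendsto_zero_iff_norm_tendsto_zero.1 hg).eventually (gt_mem_nhds (half_pos hε))
    filter_upwards [hC, h1] with i hi h1
    rw [dist_zero_right, norm_norm, ← add_sub_cancel g f, map_add]
    rw [dist_eq_norm, lt_div_iff₀ (by positivity)] at hfg
    have h2 := hi (f - g)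
    have h3 : C * ‖f - g‖ ≤ |C| * ‖f - g‖ :=
      mul_le_mul_of_nonneg_right (le_abs_self C) (norm_nonneg _)
    linarith [norm_add_le (F i g) (F i (f - g)), norm_nonneg (f - g)]
  · intro f g hf hg
    simpa using hf.add hg
  · intro c f hf
    simpa using hf.const_smul c

/-! ### Gaussian averages of momentum shifts -/

theorem norm_exp_I_mul (r : ℝ) : ‖Complex.exp (Complex.I * (r : ℂ))‖ = 1 := by
  rw [mul_comm, Complex.norm_exp_ofReal_mul_I]

theorem norm_momentumShift_apply_le (n : ℕ) (y : Fin n → ℝ) (f : HilbertE e) :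
    ‖momentumShift e n y f‖ ≤ 2 * ‖f‖ := by
  simpa using (isMultiplicationBy_momentumShift n y).norm_apply_le (C := 1)
    (fun x => (norm_exp_I_mul _).le) f

/-- The Fourier transform of the Gaussian measure with covariance `t D_n`. -/
theorem integral_exp_gaussianMomentum {d : ℕ → ℝ} (hd : ∀ k, 0 ≤ d k) (n : ℕ) {t : ℝ}
    (ht : 0 ≤ t) (z : Fin n → ℝ) :
    ∫ y, Complex.exp (Complex.I * ((∑ k : Fin n, y k * z k : ℝ) : ℂ)) ∂(gaussianMomentum d n t) =
      ((Real.exp (-(t * ∑ k : Fin n, d k * z k ^ 2 / 2)) : ℝ) : ℂ) := by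
  have h1 : ∀ y : Fin n → ℝ, Complex.exp (Complex.I * ((∑ k : Fin n, y k * z k : ℝ) : ℂ)) =
      ∏ k : Fin n, Complex.exp ((z k : ℂ) * (y k : ℂ) * Complex.I) := fun y => by
    rw [← Complex.exp_sum]
    push_cast
    rw [Finset.mul_sum]
    congr 1
    exact Finset.sum_congr rfl fun k _ => by ring
  simp_rw [h1]
  rw [gaussianMomentum, integral_fintype_prod_eq_prod
    (f := fun (k : Fin n) (r : ℝ) => Complex.exp ((z k : ℂ) * (r : ℂ) * Complex.I))]
  simp_rw [← charFun_apply_real, ProbabilityTheory.charFun_gaussianReal]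
  rw [← Complex.exp_sum, Complex.ofReal_exp]
  congr 1
  push_cast
  rw [Finset.mul_sum, ← Finset.sum_neg_distrib]
  refine Finset.sum_congr rfl fun k _ => ?_
  rw [Real.coe_toNNReal _ (mul_nonneg ht (hd k))]
  push_cast
  ring

/-- The character `z ↦ exp(i (y, z))` of `ℝ^n`, restricted to `K`. -/
def characterOn {n : ℕ} (K : Set (Fin n → ℝ)) (y : Fin n → ℝ) : C(K, ℂ) :=
  ⟨fun z => Complex.exp (Complex.I * ((∑ k : Fin n, y k * z.1 k : ℝ) : ℂ)), by
    have : Continuous fun z : Fin n → ℝ =>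
      Complex.exp (Complex.I * ((∑ k : Fin n, y k * z k : ℝ) : ℂ)) := by fun_prop
    exact this.comp continuous_subtype_val⟩

theorem continuous_characterOn {n : ℕ} (K : Set (Fin n → ℝ)) : Continuous (characterOn K) := by
  have : Continuous fun p : (Fin n → ℝ) × (Fin n → ℝ) =>
    Complex.exp (Complex.I * ((∑ k : Fin n, p.1 k * p.2 k : ℝ) : ℂ)) := by fun_prop
  exact ContinuousMap.continuous_of_continuous_uncurry _
    (this.comp (continuous_fst.prodMk (continuous_subtype_val.comp continuous_snd)))

/-- Continuous functions on a compact box `K` act on the characteristic function of a block `Q` by a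
bounded linear map `h ↦ h χ_Q`; the box is the product of the closures of the first `n` edges of `Q`,
so that `h` is defined at the first `n` coordinates of every point of `Q`. -/
theorem exists_blockMultiplication {Q : Set E} (hQ : IsMeasurableBlock e Q) (n : ℕ) :
    ∃ (K : Set (Fin n → ℝ)) (_ : CompactSpace K) (G : C(K, ℂ) →L[ℂ] HilbertE e),
      ∀ (φ : (Fin n → ℝ) → ℂ) (hφ : Continuous φ) (M : HilbertE e →L[ℂ] HilbertE e),
        IsMultiplicationBy (fun x => φ fun k => coord e k x) M →
        G ⟨fun z => φ z, hφ.comp continuous_subtype_val⟩ = M (blockVec hQ : HilbertE e) := by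
  obtain ⟨a, b, -, hab, rfl, -⟩ := id hQ
  let K : Set (Fin n → ℝ) := Icc (fun k => a k) (fun k => b k)
  have hK : CompactSpace K := isCompact_iff_compactSpace.1 isCompact_Icc
  have hmem : ∀ x ∈ block e a b, (fun k : Fin n => coord e k x) ∈ K := fun x hx =>
    ⟨fun k => (hx k).1, fun k => (hx k).2.le⟩
  -- the coordinatewise retraction of `ℝ^n` onto the box `K`
  let r : (Fin n → ℝ) → K := fun z =>
    ⟨fun k => max (a k) (min (b k) (z k)), fun k => le_max_left _ _,
      fun k => max_le (hab k).le (min_le_left _ _)⟩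
  have hr : Continuous r := by
    refine Continuous.subtype_mk (by fun_prop) _
  have hrK : ∀ z (hz : z ∈ K), r z = ⟨z, hz⟩ := fun z hz => by
    refine Subtype.ext (funext fun k => ?_)
    change max (a k) (min (b k) (z k)) = z k
    rw [min_eq_right (hz.2 k), max_eq_right (hz.1 k)]
  let m : C(K, ℂ) → HilbertE e →L[ℂ] HilbertE e := fun h =>
    mulOp e fun x => h (r fun k => coord e k x)
  have hm : ∀ h : C(K, ℂ), IsMultiplicationBy (fun x => h (r fun k => coord e k x)) (m h) :=
    fun h => isMultiplicationBy_mulOp (g := fun z => h (r z)) (by fun_prop) (C := ‖h‖)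
      fun z => h.norm_coe_le_norm _
  let G : C(K, ℂ) →ₗ[ℂ] HilbertE e :=
    { toFun := fun h => m h (blockVec hQ : HilbertE e)
      map_add' := fun h h' => (hm (h + h') _).unique (by
        convert (hm h (blockVec hQ)).add (hm h' (blockVec hQ)) using 2 with x
        exact add_mul _ _ _)
      map_smul' := fun c h => (hm (c • h) _).unique (by
        rw [RingHom.id_apply]
        convert (hm h (blockVec hQ)).smul c using 2 with x
        exact mul_assoc _ _ _) }
  refine ⟨K, hK, G.mkContinuous (2 * ‖blockVec hQ‖) fun h => ?_, fun φ hφ M hM => ?_⟩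
  · have h1 := (hm h).norm_apply_le (fun x => h.norm_coe_le_norm _) (blockVec hQ : HilbertE e)
    rw [UniformSpace.Completion.norm_coe] at h1
    exact h1.trans_eq (by ring)
  · refine (hm _ (blockVec hQ)).unique ?_
    convert hM (blockVec hQ) using 2 with x
    rw [blockVec, SimpleFunctions.mk_apply]
    by_cases hx : x ∈ block e a b
    · congr 1
      exact congrArg (fun z : K => φ z) (hrK _ (hmem x hx))
    · simp [hx]

theorem continuous_momentumShift_apply (n : ℕ) (f : HilbertE e) :
    Continuous fun y => momentumShift e n y f := by
  refine continuous_iff_continuousAt.2 fun y₀ => tendsto_sub_nhds_zero_iff.1 ?_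
  refine tendsto_zero_of_block (F := fun y => momentumShift e n y - momentumShift e n y₀) (C := 4)
    (Eventually.of_forall fun y f => ?_) (fun Q hQ => ?_) f
  · have h1 := norm_momentumShift_apply_le n y f
    have h2 := norm_momentumShift_apply_le n y₀ f
    rw [sub_apply]
    linarith [norm_sub_le (momentumShift e n y f) (momentumShift e n y₀ f)]
  · obtain ⟨K, hK, G, hG⟩ := exists_blockMultiplication hQ n
    have h1 : ∀ y, momentumShift e n y (blockVec hQ : HilbertE e) = G (characterOn K y) :=
      fun y => (hG (fun z => Complex.exp (Complex.I * ((∑ k : Fin n, y k * z k : ℝ) : ℂ)))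
        (by fun_prop) _ (isMultiplicationBy_momentumShift n y)).symm
    have h2 : Continuous fun y => momentumShift e n y (blockVec hQ : HilbertE e) := by
      simp_rw [h1]
      exact G.continuous.comp (continuous_characterOn K)
    exact tendsto_sub_nhds_zero_iff.2 (h2.tendsto y₀)

instance (d : ℕ → ℝ) (n : ℕ) (t : ℝ) : IsProbabilityMeasure (gaussianMomentum d n t) := by
  rw [gaussianMomentum]
  infer_instance

theorem integrable_momentumShift_apply (d : ℕ → ℝ) (n : ℕ) (t : ℝ) (f : HilbertE e) :
    Integrable (fun y => momentumShift e n y f) (gaussianMomentum d n t) :=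
  Integrable.of_bound (continuous_momentumShift_apply n f).aestronglyMeasurable (2 * ‖f‖)
    (Eventually.of_forall fun y => norm_momentumShift_apply_le n y f)

theorem norm_momentumAveraging_apply_le {d : ℕ → ℝ} (hd : ∀ k, 0 ≤ d k) (n : ℕ) {t : ℝ}
    (ht : 0 ≤ t) (f : HilbertE e) : ‖momentumAveraging e d n t f‖ ≤ 2 * ‖f‖ := by
  simpa using (isMultiplicationBy_momentumAveraging hd n ht).norm_apply_le (C := 1) (fun x => by
    rw [Complex.norm_real, Real.norm_of_nonneg (Real.exp_pos _).le, Real.exp_le_one_iff, neg_nonpos]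
    exact mul_nonneg ht (Finset.sum_nonneg fun k _ => by have := hd k; positivity)) f

/-- The averaging operator is the Gaussian average of the shifts, as a Bochner integral. On the
characteristic function of a block both sides are images under the bounded linear map of
`exists_blockMultiplication`, which commutes with the integral. -/
theorem momentumAveraging_apply_eq_integral {d : ℕ → ℝ} (hd : ∀ k, 0 ≤ d k) (n : ℕ) {t : ℝ}
    (ht : 0 ≤ t) (f : HilbertE e) :
    momentumAveraging e d n t f = ∫ y, momentumShift e n y f ∂(gaussianMomentum d n t) := by
  have hint := integrable_momentumShift_apply (e := e) d n t
  let I : HilbertE e →L[ℂ] HilbertE e := LinearMap.mkContinuous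
    { toFun := fun f => ∫ y, momentumShift e n y f ∂(gaussianMomentum d n t)
      map_add' := fun f g => by simp_rw [map_add]; exact integral_add (hint f) (hint g)
      map_smul' := fun c f => by simp_rw [map_smul]; exact integral_smul c _ } 2 fun f => by
        simpa using norm_integral_le_of_norm_le_const (μ := gaussianMomentum d n t)
          (Eventually.of_forall fun y => norm_momentumShift_apply_le n y f)
  change _ = I f
  refine HilbertE.induction_block (p := fun f => momentumAveraging e d n t f = I f)
    (isClosed_eq (by fun_prop) (by fun_prop)) (fun f g hf hg => by rw [map_add, map_add, hf, hg])
    (fun c f hf => by rw [map_smul, map_smul, hf]) (fun Q hQ => ?_) f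
  change _ = ∫ y, momentumShift e n y (blockVec hQ : HilbertE e) ∂(gaussianMomentum d n t)
  obtain ⟨K, hK, G, hG⟩ := exists_blockMultiplication hQ n
  have hi : Integrable (characterOn K) (gaussianMomentum d n t) :=
    Integrable.of_bound (continuous_characterOn K).aestronglyMeasurable 1
      (Eventually.of_forall fun y =>
        (ContinuousMap.norm_le _ zero_le_one).2 fun z => (norm_exp_I_mul _).le)
  have h1 : ∀ y, momentumShift e n y (blockVec hQ : HilbertE e) = G (characterOn K y) :=
    fun y => (hG (fun z => Complex.exp (Complex.I * ((∑ k : Fin n, y k * z k : ℝ) : ℂ)))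
      (by fun_prop) _ (isMultiplicationBy_momentumShift n y)).symm
  simp_rw [h1]
  rw [G.integral_comp_comm hi, ← hG
    (fun z => ((Real.exp (-(t * ∑ k : Fin n, d k * z k ^ 2 / 2)) : ℝ) : ℂ)) (by fun_prop) _
    (isMultiplicationBy_momentumAveraging hd n ht)]
  congr 1
  ext z
  rw [ContinuousMap.integral_apply hi]
  exact (integral_exp_gaussianMomentum hd n ht z.1).symm

/-! ### Nuclear diagonal operators -/

/-- The eigenvalues of a nuclear non-negative diagonal operator are summable: by the inequalities of
Cauchy–Schwarz and Bessel their sum is at most `∑ ‖x_n‖ ‖y_n‖` for every nuclear representation. -/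
theorem IsNuclear.summable_eigenvalues {D : E →L[ℝ] E} (hD : IsNuclear D) {d : ℕ → ℝ}
    (hd : ∀ k, D (e k) = d k • e k) (hd0 : ∀ k, 0 ≤ d k) : Summable d := by
  obtain ⟨x, y, hs, hxy⟩ := hD
  refine summable_of_sum_le hd0 (c := ∑' n, ‖x n‖ * ‖y n‖) fun u => ?_
  have h1 : ∀ k, HasSum (fun n => inner ℝ (x n) (e k) * inner ℝ (e k) (y n)) (d k) := fun k => by
    have h2 := (innerSL ℝ (e k)).hasSum (hxy (e k))
    rw [hd k] at h2
    simpa [inner_smul_right, e.orthonormal.1 k] using h2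
  refine hasSum_le (fun n => ?_) (hasSum_sum fun k (_ : k ∈ u) => h1 k) hs.hasSum
  refine abs_le_of_sq_le_sq' ?_ (by positivity) |>.2
  have hx := e.orthonormal.sum_inner_products_le (x n) (s := u)
  have hy := e.orthonormal.sum_inner_products_le (y n) (s := u)
  simp only [Real.norm_eq_abs, sq_abs] at hx hy
  refine (Finset.sum_mul_sq_le_sq_mul_sq u _ _).trans ?_
  rw [mul_pow]
  simp only [real_inner_comm (e _) (x n)] at hx ⊢
  exact mul_le_mul hx hy (Finset.sum_nonneg fun _ _ => sq_nonneg _) (sq_nonneg _)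

/-! ### The limit semigroup -/

theorem abs_exp_neg_sub_exp_neg_le {a b : ℝ} (ha : 0 ≤ a) (hb : 0 ≤ b) :
    |Real.exp (-a) - Real.exp (-b)| ≤ |a - b| := by
  wlog hab : a ≤ b generalizing a b
  · rw [abs_sub_comm, abs_sub_comm a]
    exact this hb ha (le_of_not_ge hab)
  have h1 := Real.add_one_le_exp (-(b - a))
  have h2 : Real.exp (-b) = Real.exp (-a) * Real.exp (-(b - a)) := by
    rw [← Real.exp_add]
    ring_nf
  have h3 : Real.exp (-a) ≤ 1 := Real.exp_le_one_iff.2 (by linarith)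
  have h4 : Real.exp (-b) ≤ Real.exp (-a) := Real.exp_le_exp.2 (by linarith)
  rw [abs_of_nonneg (sub_nonneg.2 h4), abs_sub_comm, abs_of_nonneg (sub_nonneg.2 hab)]
  nlinarith [Real.exp_pos (-a)]

/-- On a bounded block the quadratic forms `∑_{k < n} d_k x_k² / 2` are uniformly close to one
another, as soon as the partial sums of `d` are. -/
theorem abs_sum_sub_sum_le {d : ℕ → ℝ} (hd : ∀ k, 0 ≤ d k) {C : ℝ} {x : E}
    (hx : ∀ k, coord e k x ^ 2 ≤ C) (n m : ℕ) :
    |∑ k : Fin n, d k * coord e k x ^ 2 / 2 - ∑ k : Fin m, d k * coord e k x ^ 2 / 2| ≤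
      C * |∑ k ∈ Finset.range n, d k - ∑ k ∈ Finset.range m, d k| := by
  rw [← Finset.sum_range (fun k => d k * coord e k x ^ 2 / 2),
    ← Finset.sum_range (fun k => d k * coord e k x ^ 2 / 2)]
  wlog hmn : m ≤ n generalizing n m
  · rw [abs_sub_comm, abs_sub_comm (∑ k ∈ Finset.range n, d k)]
    exact this m n (le_of_not_ge hmn)
  rw [← Finset.sum_Ico_eq_sub _ hmn, ← Finset.sum_Ico_eq_sub _ hmn,
    abs_of_nonneg (Finset.sum_nonneg fun k _ => by have := hd k; positivity),
    abs_of_nonneg (Finset.sum_nonneg fun k _ => hd k), Finset.mul_sum]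
  refine Finset.sum_le_sum fun k _ => ?_
  nlinarith [mul_le_mul_of_nonneg_left (hx k) (hd k), mul_nonneg (hd k) (sq_nonneg (coord e k x))]

theorem IsMeasurableBlock.exists_coord_sq_le {Q : Set E} (hQ : IsMeasurableBlock e Q) :
    ∃ C, 0 ≤ C ∧ ∀ x ∈ Q, ∀ k, coord e k x ^ 2 ≤ C := by
  obtain ⟨a, b, ⟨M, hM⟩, -, rfl, -⟩ := hQ
  refine ⟨M ^ 2, sq_nonneg M, fun x hx k => sq_le_sq.2 ?_⟩
  refine (abs_le.2 ⟨?_, ?_⟩).trans (le_abs_self M)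
  · linarith [(abs_le.1 (hM k).1).1, (hx k).1]
  · linarith [(abs_le.1 (hM k).2).2, (hx k).2]

theorem sum_eigenvalue_mul_sq_nonneg {d : ℕ → ℝ} (hd : ∀ k, 0 ≤ d k) (n : ℕ) (x : E) :
    0 ≤ ∑ k : Fin n, d k * coord e k x ^ 2 / 2 :=
  Finset.sum_nonneg fun k _ => by have := hd k; positivity

theorem norm_momentumAveraging_sub_blockVec_le {d : ℕ → ℝ} (hd : ∀ k, 0 ≤ d k) {n m : ℕ} {s t : ℝ}
    (hs : 0 ≤ s) (ht : 0 ≤ t) {Q : Set E} (hQ : IsMeasurableBlock e Q) {c : ℝ} (hc : 0 ≤ c)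
    (h : ∀ x ∈ Q, |s * ∑ k : Fin n, d k * coord e k x ^ 2 / 2 -
      t * ∑ k : Fin m, d k * coord e k x ^ 2 / 2| ≤ c) :
    ‖momentumAveraging e d n s (blockVec hQ : HilbertE e) - momentumAveraging e d m t (blockVec hQ)‖ ≤
      2 * c * ‖blockVec hQ‖ := by
  refine ((isMultiplicationBy_momentumAveraging hd n hs).sub
    (isMultiplicationBy_momentumAveraging hd m ht)).norm_apply_blockVec_le hQ hc fun x hx => ?_
  rw [← Complex.ofReal_sub, Complex.norm_real, Real.norm_eq_abs]
  exact (abs_exp_neg_sub_exp_neg_le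
    (mul_nonneg hs (sum_eigenvalue_mul_sq_nonneg hd n x))
    (mul_nonneg ht (sum_eigenvalue_mul_sq_nonneg hd m x))).trans (h x hx)

theorem momentumAveraging_zero {d : ℕ → ℝ} (hd : ∀ k, 0 ≤ d k) (n : ℕ) :
    momentumAveraging e d n 0 = ContinuousLinearMap.id ℂ (HilbertE e) :=
  (isMultiplicationBy_momentumAveraging hd n le_rfl).unique (by
    convert isMultiplicationBy_id using 2
    simp)

theorem momentumAveraging_add {d : ℕ → ℝ} (hd : ∀ k, 0 ≤ d k) (n : ℕ) {s t : ℝ} (hs : 0 ≤ s)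
    (ht : 0 ≤ t) :
    momentumAveraging e d n (s + t) =
      (momentumAveraging e d n s).comp (momentumAveraging e d n t) := by
  refine (isMultiplicationBy_momentumAveraging hd n (add_nonneg hs ht)).unique ?_
  convert (isMultiplicationBy_momentumAveraging hd n hs).comp
    (isMultiplicationBy_momentumAveraging hd n ht) (C := 1) fun x => ?_ using 2 with x
  · rw [← Complex.ofReal_mul, ← Real.exp_add]
    ring_nf
  · rw [Complex.norm_real, Real.norm_of_nonneg (Real.exp_pos _).le, Real.exp_le_one_iff, neg_nonpos]
    exact mul_nonneg hs (sum_eigenvalue_mul_sq_nonneg hd n x)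

theorem continuousOn_momentumAveraging_apply {d : ℕ → ℝ} (hd : ∀ k, 0 ≤ d k) (n : ℕ)
    (f : HilbertE e) : ContinuousOn (fun t => momentumAveraging e d n t f) (Ici 0) := by
  intro t ht
  refine tendsto_sub_nhds_zero_iff.1 ?_
  refine tendsto_zero_of_block
    (F := fun s => momentumAveraging e d n s - momentumAveraging e d n t) (C := 4)
    (eventually_mem_nhdsWithin.mono fun s hs f => ?_) (fun Q hQ => ?_) f
  · have h1 := norm_momentumAveraging_apply_le hd n hs f
    have h2 := norm_momentumAveraging_apply_le hd n ht f
    rw [sub_apply]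
    linarith [norm_sub_le (momentumAveraging e d n s f) (momentumAveraging e d n t f)]
  · obtain ⟨C, hC0, hC⟩ := hQ.exists_coord_sq_le
    have hsum : 0 ≤ ∑ k ∈ Finset.range n, d k := Finset.sum_nonneg fun k _ => hd k
    refine squeeze_zero_norm' (a := fun s => 2 * (|s - t| * (C * ∑ k ∈ Finset.range n, d k)) *
      ‖blockVec hQ‖) (eventually_mem_nhdsWithin.mono fun s hs => ?_) ?_
    · refine norm_momentumAveraging_sub_blockVec_le hd hs ht hQ (by positivity) fun x hx => ?_
      rw [← sub_mul, abs_mul]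
      refine mul_le_mul_of_nonneg_left ?_ (abs_nonneg _)
      -- for `m = 0` the second form vanishes and the bound is for the form itself
      simpa [abs_of_nonneg hsum] using abs_sum_sub_sum_le hd (hC x hx) n 0
    · have : Continuous fun s => 2 * (|s - t| * (C * ∑ k ∈ Finset.range n, d k)) *
        ‖blockVec hQ‖ := by fun_prop
      simpa using (this.tendsto t).mono_left nhdsWithin_le_nhds

theorem uniformCauchySeqOn_momentumAveraging {d : ℕ → ℝ} (hd : ∀ k, 0 ≤ d k) (hs : Summable d)
    {T : ℝ} (hT : 0 < T) (f : HilbertE e) :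
    UniformCauchySeqOn (fun n t => momentumAveraging e d n t f) atTop (Icc 0 T) := by
  have key : Tendsto (fun i : (ℕ × ℕ) × ℝ => momentumAveraging e d i.1.1 i.2 f -
      momentumAveraging e d i.1.2 i.2 f) ((atTop ×ˢ atTop) ×ˢ 𝓟 (Icc 0 T)) (𝓝 0) := by
    have hmem : ∀ᶠ i : (ℕ × ℕ) × ℝ in (atTop ×ˢ atTop) ×ˢ 𝓟 (Icc 0 T), i.2 ∈ Icc 0 T :=
      tendsto_snd.eventually (mem_principal_self (Icc 0 T))
    refine tendsto_zero_of_block (C := 4) (F := fun i : (ℕ × ℕ) × ℝ =>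
      momentumAveraging e d i.1.1 i.2 - momentumAveraging e d i.1.2 i.2)
      (hmem.mono fun i hi f => ?_) (fun Q hQ => ?_) f
    · have h1 := norm_momentumAveraging_apply_le hd i.1.1 hi.1 f
      have h2 := norm_momentumAveraging_apply_le hd i.1.2 hi.1 f
      rw [sub_apply]
      linarith [norm_sub_le (momentumAveraging e d i.1.1 i.2 f)
        (momentumAveraging e d i.1.2 i.2 f)]
    · obtain ⟨C, hC0, hC⟩ := hQ.exists_coord_sq_le
      refine squeeze_zero_norm' (a := fun i : (ℕ × ℕ) × ℝ => 2 * (T * (C *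
        |∑ k ∈ Finset.range i.1.1, d k - ∑ k ∈ Finset.range i.1.2, d k|)) * ‖blockVec hQ‖)
        (hmem.mono fun i hi => ?_) ?_
      · refine norm_momentumAveraging_sub_blockVec_le hd hi.1 hi.1 hQ (by positivity)
          fun x hx => ?_
        rw [← mul_sub, abs_mul, abs_of_nonneg hi.1]
        exact mul_le_mul hi.2 (abs_sum_sub_sum_le hd (hC x hx) _ _) (abs_nonneg _) hT.le
      · have h1 := hs.hasSum.tendsto_sum_nat
        have h2 := (h1.comp (tendsto_fst.comp (tendsto_fst (f := atTop ×ˢ atTop)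
          (g := 𝓟 (Icc 0 T))))).sub (h1.comp (tendsto_snd.comp tendsto_fst))
        rw [sub_self] at h2
        simpa using (((h2.abs.const_mul C).const_mul T).const_mul 2).mul_const ‖blockVec hQ‖
  rw [uniformCauchySeqOn_iff_uniformCauchySeqOnFilter]
  intro u hu
  obtain ⟨ε, hε, hεu⟩ := Metric.mem_uniformity_dist.1 hu
  filter_upwards [(tendsto_zero_iff_norm_tendsto_zero.1 key).eventually (gt_mem_nhds hε)] with i hi
  exact hεu (by rwa [dist_eq_norm])

/-- The averaging operators converge strongly, uniformly on bounded time intervals, to a strongly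
continuous semigroup; the limit is bounded by the Banach–Steinhaus theorem. -/
theorem exists_semigroup {d : ℕ → ℝ} (hd : ∀ k, 0 ≤ d k) (hs : Summable d) :
    ∃ A : ℝ → (HilbertE e →L[ℂ] HilbertE e),
      (∀ T : ℝ, 0 < T → ∀ f : HilbertE e,
        TendstoUniformlyOn (fun (n : ℕ) (t : ℝ) => momentumAveraging e d n t f)
          (fun t => A t f) atTop (Icc 0 T)) ∧
      IsStronglyContinuousSemigroup A := by
  have hex : ∀ t : ℝ, ∃ A : HilbertE e →L[ℂ] HilbertE e, 0 ≤ t →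
      ∀ f, Tendsto (fun n => momentumAveraging e d n t f) atTop (𝓝 (A f)) := fun t => by
    by_cases ht : 0 ≤ t
    · have h1 : ∀ f : HilbertE e, ∃ u,
          Tendsto (fun n => momentumAveraging e d n t f) atTop (𝓝 u) := fun f =>
        cauchySeq_tendsto_of_complete
          ((uniformCauchySeqOn_momentumAveraging hd hs (T := t + 1) (by linarith) f).cauchySeq
            ⟨ht, by linarith⟩)
      choose u hu using h1
      exact ⟨continuousLinearMapOfTendsto (fun n => momentumAveraging e d n t)
        (tendsto_pi_nhds.2 hu), fun _ => hu⟩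
    · exact ⟨0, fun h => absurd h ht⟩
  choose A hA using hex
  have hunif : ∀ T : ℝ, 0 < T → ∀ f : HilbertE e,
      TendstoUniformlyOn (fun (n : ℕ) (t : ℝ) => momentumAveraging e d n t f)
        (fun t => A t f) atTop (Icc 0 T) := fun T hT f =>
    (uniformCauchySeqOn_momentumAveraging hd hs hT f).tendstoUniformlyOn_of_tendsto
      fun t ht => hA t ht.1 f
  refine ⟨A, hunif, ⟨?_, fun s t hs' ht => ?_, fun f t ht => ?_⟩⟩
  · ext f
    refine tendsto_nhds_unique (hA 0 le_rfl f) ?_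
    simp_rw [momentumAveraging_zero hd]
    exact tendsto_const_nhds
  · ext f
    refine tendsto_nhds_unique (hA _ (add_nonneg hs' ht) f) ?_
    simp_rw [momentumAveraging_add hd _ hs' ht, ContinuousLinearMap.comp_apply]
    refine tendsto_iff_norm_sub_tendsto_zero.2 ?_
    have h1 := tendsto_iff_norm_sub_tendsto_zero.1 (hA t ht f)
    have h2 := tendsto_iff_norm_sub_tendsto_zero.1 (hA s hs' (A t f))
    refine squeeze_zero (fun _ => norm_nonneg _) (fun n => ?_)
      (by simpa using (h1.const_mul 2).add h2)
    have h3 := norm_momentumAveraging_apply_le hd n hs' (momentumAveraging e d n t f - A t f)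
    refine (norm_sub_le_norm_sub_add_norm_sub _ (momentumAveraging e d n s (A t f)) _).trans ?_
    rw [← map_sub]
    linarith
  · -- `[0, t + 1]` is a neighbourhood of `t` in the half-line
    have h1 : ContinuousOn (fun t => A t f) (Icc 0 (t + 1)) :=
      (hunif (t + 1) (by linarith [mem_Ici.1 ht]) f).continuousOn
        (Frequently.of_forall fun n =>
          (continuousOn_momentumAveraging_apply hd n f).mono Icc_subset_Ici_self)
    refine (h1 t ⟨ht, by linarith⟩).mono_of_mem_nhdsWithin ?_
    rw [← Ici_inter_Iic]
    exact inter_mem_nhdsWithin _ (Iic_mem_nhds (by linarith))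

end MomentumAveraging

end

theorem mainTheorem8 {E : Type*} [NormedAddCommGroup E] [InnerProductSpace ℝ E]
    (e : HilbertBasis ℕ ℝ E) (D : E →L[ℝ] E) (hD : D.IsPositive)
    (hnuc : MomentumAveraging.IsNuclear D) (d : ℕ → ℝ) (hd : ∀ k, D (e k) = d k • e k) :
    -- `Û_{tD_n}` is the average, in the sense of Pettis, of the momentum shifts with respect to
    -- the centered Gaussian measure with covariance `t D_n`
    (∀ (n : ℕ) (t : ℝ), 0 ≤ t → ∀ f g : MomentumAveraging.HilbertE e,
      MeasureTheory.Integrable (fun y => inner ℂ g (MomentumAveraging.momentumShift e n y f))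
        (MomentumAveraging.gaussianMomentum d n t) ∧
      inner ℂ g (MomentumAveraging.momentumAveraging e d n t f) =
        ∫ y, inner ℂ g (MomentumAveraging.momentumShift e n y f)
          ∂(MomentumAveraging.gaussianMomentum d n t)) ∧
    -- the operators `Û_{tD_n}` converge strongly, uniformly on bounded intervals of `t ≥ 0`, to a
    -- strongly continuous semigroup `A_{tD}`
    ∃ A : ℝ → (MomentumAveraging.HilbertE e →L[ℂ] MomentumAveraging.HilbertE e),
      (∀ (T : ℝ), 0 < T → ∀ f : MomentumAveraging.HilbertE e,
        TendstoUniformlyOn (fun (n : ℕ) (t : ℝ) => MomentumAveraging.momentumAveraging e d n t f)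
          (fun t => A t f) Filter.atTop (Set.Icc 0 T)) ∧
      MomentumAveraging.IsStronglyContinuousSemigroup A := by
  have hd0 : ∀ k, 0 ≤ d k := fun k => by
    have h1 := hD.re_inner_nonneg_right (e k)
    simpa [hd k, inner_smul_right, e.orthonormal.1 k] using h1
  refine ⟨fun n t ht f g => ?_,
    MomentumAveraging.exists_semigroup hd0 (hnuc.summable_eigenvalues hd hd0)⟩
  have hi := MomentumAveraging.integrable_momentumShift_apply (e := e) d n t f
  refine ⟨hi.const_inner g, ?_⟩
  rw [MomentumAveraging.momentumAveraging_apply_eq_integral hd0 n ht f, integral_inner hi]
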